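/- \textbf{Setting.} Let $D,M\ge 1$, let $\gamma_1,\dots,\gamma_M\ge 0$ with $\sum_i\gamma_i=1$, and let $P_0,P_1,\dots,P_M$ be probability measures on $[0,1]^D$. Let $S_i=\operatorname{supp}(P_i)$ for $1\le i\le M$ and $S_0=[0,1]^D\setminus\bigcup_{i=1}^M S_i$, and assume $\operatorname{supp}(P_0)\subseteq\overline{S_0}$ and $P_0(\overline{S_0}\cap S_i)=0$ for $1\le i\le M$. For $0\le\varepsilon<1$ let $X_1,\dots,X_n$ be independent with common law $\varepsilon P_0+(1-\varepsilon)\sum_{i=1}^M\gamma_iP_i$. Let $\mathcal H^s$ be the (normalized) $s$-dimensional Hausdorff measure, $s_i=\dim_H S_i$, $d=\max_i s_i$, $\Delta_i=\operatorname{diam}S_i$, $\eta(s)=\pi^{s/2}/\Gamma(1+s/2)$, $\gamma_*=\min_i\gamma_i$, $\gamma^*=\max_i\gamma_i$, $\bar\gamma=\gamma_*-\gamma^*/2$. Assume, for some constants $\delta,\kappa_0,\kappa_1,\dots,\kappa_M>0$ and $\kappa_c\ge1$: \begin{itemize} \item (A1) every $S_i$, $1\le i\le M$, is connected, and $\|x-y\|\ge\delta$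 for $x\in S_i$, $y\in S_j$, $i\ne j$; \item (A2) $P_0(A)\le\kappa_0\mathcal H^D(A)$ for all Borel $A\subseteq S_0$; \item (A3) $P_i(A)\ge\kappa_i^{-1}\mathcal H^{s_i}(A)$ for all Borel $A\subseteq S_i$, $1\le i\le M$; \item (A4) $\kappa_c^{-1}\le \mathcal H^{s_i}(S_i\cap B(x,r))/(\eta(s_i)r^{s_i})\le\kappa_c$ for $1\le i\le M$, $x\in S_i$, $0<r\le\Delta_i$, where $B(x,r)$ is the closed ball; \item (A5) $s_i=\lim_{r\to0}\log N_r(S_i)/\log(1/r)$ for $1\le i\le M$, where $N_r(S)$ is the minimal number of open balls of radius $r$ that cover $S$; \item (A6) $\gamma^*<2\gamma_*$ and $0\le\varepsilon<\bar\gamma/(1+\bar\gamma)$. \end{itemize} \textbf{Algorithm and risk.} For $r\ge0$, the single linkage clusters of radius $r$ are the classes of observations (counted with multiplicity) that lie in the same connected component of $\bigcup_k B(X_k,r/2)$. Order them by decreasing size, ties being broken in favour of the cluster with the smallest first index, and let $\mathcal X_m(r)$ be the $m$-th one, or $\emptyset$ if there are fewer than $m$ clusters. Let $\rho_0=0$ and,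 as long as there are at least two clusters of radius $\rho_k$, let $\rho_{k+1}$ be the distance between the two closest of them. Let $\widehat r_n$ be the largest maximizer of $|\mathcal X_M(\rho)|$ over all these radii $\rho$. The clustering risk of the family $\mathcal X_1(\widehat r_n),\dots,\mathcal X_M(\widehat r_n)$ is $$R_n=\mathbb P\bigl(\text{for every permutation }\pi\text{ of }\{1,\dots,M\}\text{ there is an }i\text{ such that }\mathcal X_{\pi(i)}(\widehat r_n)\text{ does not contain all observations in }S_i\bigr).$$ \textbf{Statement.} There are constants $C_1,C_2>0$ that depend only on $D$, $M$, $d$, $\delta$, $\gamma_1,\dots,\gamma_M$, $\kappa_0,\dots,\kappa_M$, $\kappa_c$ (in particular not on $n$, $\varepsilon$ or $\beta$) such that, under the assumptions above and for all $n\ge M$: \begin{enumerate} \item if $\varepsilon=e^{-n}$, then $R_n\le C_1n\exp(-C_2n)$; \item if $D>d+1$, then $R_n\le C_1n\exp(-C_2n^{1/(d+1)})$; \item if $d\le D\le d+1$ and $\varepsilon=n^{-\beta}$ with $\beta\ge1-D/(d+1)$, then $R_n\le C_1n^{d/(d+1)}\exp(-C_2n^{1/(d+1)})$; \item if $d\le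 D\le d+1$ and $\varepsilon=n^{-\beta}$ with $0<\beta<1-D/(d+1)$, then $R_n\le C_1n^{(1-\beta)d/D}\exp(-C_2n^{1+(\beta-1)d/D})$. \end{enumerate} -/

import Mathlib

open MeasureTheory ProbabilityTheory Filter Topology

noncomputable section

namespace OSL

/-! ### The generative model -/

/-- The ambient Euclidean space `ℝ^D`. -/
abbrev Space (D : ℕ) : Type := EuclideanSpace ℝ (Fin D)

/-- The unit cube `[0,1]^D`. -/
def cube (D : ℕ) : Set (Space D) := {x | ∀ j, x j ∈ Set.Icc (0 : ℝ) 1}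

/-- The set `S₀ = [0,1]^D \ (S₁ ∪ ⋯ ∪ S_M)`, where `S_i` is the support of `P_i`. -/
def outlierSet {D M : ℕ} (P : Fin M → Measure (Space D)) : Set (Space D) :=
  cube D \ ⋃ i, (P i).support

/-- The standing requirements on the mixture components: `P₀` (distribution of the outliers) and
`P₁, …, P_M` (distributions of the groups) are probability measures on `[0,1]^D`, the `γ_i` are
convex weights, `supp P₀ ⊆ adh S₀` and `P₀ (adh S₀ ∩ S_i) = 0`. -/
structure IsModel {D M : ℕ} (P₀ : Measure (Space D)) (P : Fin M → Measure (Space D))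
    (γ : Fin M → ℝ) : Prop where
  prob₀ : IsProbabilityMeasure P₀
  prob : ∀ i, IsProbabilityMeasure (P i)
  cube₀ : P₀ (cube D)ᶜ = 0
  cube : ∀ i, P i (cube D)ᶜ = 0
  weight_nonneg : ∀ i, 0 ≤ γ i
  weight_sum : ∑ i, γ i = 1
  support₀ : P₀.support ⊆ closure (outlierSet P)
  inter₀ : ∀ i, P₀ (closure (outlierSet P) ∩ (P i).support) = 0

/-- The mixture `ε P₀ + (1 - ε) ∑ γ_i P_i`. -/
def mixture {D M : ℕ} (P₀ : Measure (Space D)) (P : Fin M → Measure (Space D))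
    (γ : Fin M → ℝ) (ε : ℝ) : Measure (Space D) :=
  ENNReal.ofReal ε • P₀ + ENNReal.ofReal (1 - ε) • ∑ i, ENNReal.ofReal (γ i) • P i

/-- `X₁, …, X_n` are independent random variables with common distribution `ν`. -/
structure IsSample {Ω : Type*} [MeasurableSpace Ω] (μ : Measure Ω) {D n : ℕ}
    (X : Fin n → Ω → Space D) (ν : Measure (Space D)) : Prop where
  measurable : ∀ k, Measurable (X k)
  indep : iIndepFun X μ
  law : ∀ k, μ.map (X k) = ν

/-! ### Dimensions and assumptions -/

/-- `η(s) = π^{s/2} / Γ(1 + s/2)`, the volume of the unit ball in dimension `s`. -/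
def ballVol (s : ℝ) : ℝ := Real.pi ^ (s / 2) / Real.Gamma (1 + s / 2)

/-- The `s`-dimensional Hausdorff measure with the usual geometric normalization
(covering sets `A` are weighted by `η(s) (diam A / 2)^s`), so that it is Lebesgue measure
when `s = D`. Mathlib's `μH[s]` uses the weights `(diam A)^s`. -/
def hausdorff (D : ℕ) (s : ℝ) : Measure (Space D) :=
  ENNReal.ofReal (ballVol s / 2 ^ s) • Measure.hausdorffMeasure s

/-- The Hausdorff dimension of a subset of `ℝ^D`, as a real number. -/
def dim {D : ℕ} (S : Set (Space D)) : ℝ := (dimH S).toReal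

/-- `d = max_i dim_H (S_i)`. -/
def maxDim {D M : ℕ} (P : Fin M → Measure (Space D)) : ℝ := ⨆ i, dim (P i).support

/-- The minimal number of open balls of radius `r` needed to cover `S`. -/
def coveringNumber {D : ℕ} (S : Set (Space D)) (r : ℝ) : ℕ :=
  sInf {N | ∃ t : Finset (Space D), t.card = N ∧ S ⊆ ⋃ c ∈ t, Metric.ball c r}

/-- (A1): the supports are connected, and any two distinct supports are at distance at least
`δ > 0`. -/
def A1 {D M : ℕ} (P : Fin M → Measure (Space D)) (δ : ℝ) : Prop :=
  (∀ i, IsConnected (P i).support) ∧ 0 < δ ∧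
    ∀ i j, i ≠ j → ∀ x ∈ (P i).support, ∀ y ∈ (P j).support, δ ≤ ‖x - y‖

/-- (A2): `P₀ ≤ κ₀ ℋ^D` on `S₀`. -/
def A2 {D M : ℕ} (P₀ : Measure (Space D)) (P : Fin M → Measure (Space D)) (κ₀ : ℝ) : Prop :=
  0 < κ₀ ∧ ∀ A ⊆ outlierSet P, MeasurableSet A →
    P₀ A ≤ ENNReal.ofReal κ₀ * hausdorff D D A

/-- (A3): `P_i ≥ κ_i⁻¹ ℋ^{s_i}` on `S_i`. -/
def A3 {D M : ℕ} (P : Fin M → Measure (Space D)) (κ : Fin M → ℝ) : Prop :=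
  ∀ i, 0 < κ i ∧ ∀ A ⊆ (P i).support, MeasurableSet A →
    ENNReal.ofReal (κ i)⁻¹ * hausdorff D (dim (P i).support) A ≤ P i A

/-- (A4): `κ_c⁻¹ ≤ ℋ^{s_i}(S_i ∩ B(x,r)) / (η(s_i) r^{s_i}) ≤ κ_c` for all `x ∈ S_i` and
`0 < r ≤ diam S_i`. -/
def A4 {D M : ℕ} (P : Fin M → Measure (Space D)) (κc : ℝ) : Prop :=
  1 ≤ κc ∧ ∀ i, ∀ x ∈ (P i).support, ∀ r : ℝ, 0 < r → r ≤ Metric.diam (P i).support →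
    ENNReal.ofReal (κc⁻¹ * (ballVol (dim (P i).support) * r ^ dim (P i).support)) ≤
        hausdorff D (dim (P i).support) ((P i).support ∩ Metric.closedBall x r) ∧
      hausdorff D (dim (P i).support) ((P i).support ∩ Metric.closedBall x r) ≤
        ENNReal.ofReal (κc * (ballVol (dim (P i).support) * r ^ dim (P i).support))

/-- (A5): the Hausdorff dimension of `S_i` is its Minkowski–Bouligand dimension. -/
def A5 {D M : ℕ} (P : Fin M → Measure (Space D)) : Prop :=
  ∀ i, Tendsto (fun r : ℝ => Real.log (coveringNumber (P i).support r) / Real.log (1 / r))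
    (𝓝[>] 0) (𝓝 (dim (P i).support))

/-- `γ̄ = γ_* - γ^*/2`, where `γ_*` and `γ^*` are the smallest and the largest weight. -/
def gammaBar {M : ℕ} (γ : Fin M → ℝ) : ℝ := (⨅ i, γ i) - (⨆ i, γ i) / 2

/-- (A6): `γ^* < 2 γ_*` and `0 ≤ ε < γ̄ / (1 + γ̄)`. -/
def A6 {M : ℕ} (γ : Fin M → ℝ) (ε : ℝ) : Prop :=
  (⨆ i, γ i) < 2 * (⨅ i, γ i) ∧ 0 ≤ ε ∧ ε < gammaBar γ / (1 + gammaBar γ)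

/-! ### Single linkage and the OSL algorithm

Clusters are recorded as sets of indices `k` of observations `x k`, so that repeated observations
are counted with multiplicity. -/

open scoped Classical in
/-- The single linkage cluster of radius `r` that contains the observation `k`: all observations
in the connected component of `x k` in the union of the closed balls `B(x l, r/2)`. -/
def cluster {D n : ℕ} (x : Fin n → Space D) (r : ℝ) (k : Fin n) : Finset (Fin n) :=
  Finset.univ.filter fun l =>
    x l ∈ connectedComponentIn (⋃ m, Metric.closedBall (x m) (r / 2)) (x k)

/-- The family `𝒴(r)` of all single linkage clusters of radius `r`. -/
def clusters {D n : ℕ} (x : Fin n → Space D) (r : ℝ) : Finset (Finset (Fin n)) :=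
  Finset.univ.image (cluster x r)

/-- The single linkage distance of two clusters. -/
def linkDist {D n : ℕ} (x : Fin n → Space D) (A B : Finset (Fin n)) : ℝ :=
  sInf {t | ∃ k ∈ A, ∃ l ∈ B, t = ‖x k - x l‖}

/-- The merging radii: `ρ₀ = 0`, and `ρ_{k+1}` is the distance between the two closest clusters
of `𝒴(ρ_k)`, as long as there are at least two; once a single cluster is left, the sequence
stays constant. -/
def mergeRadius {D n : ℕ} (x : Fin n → Space D) : ℕ → ℝ
  | 0 => 0
  | k + 1 =>
    if 2 ≤ (clusters x (mergeRadius x k)).card then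
      sInf {t | ∃ A ∈ clusters x (mergeRadius x k), ∃ B ∈ clusters x (mergeRadius x k),
        A ≠ B ∧ t = linkDist x A B}
    else mergeRadius x k

/-- All merging radii. Each step merges at least two clusters, so that the sequence is
stationary after at most `n - 1` steps. -/
def radii {D n : ℕ} (x : Fin n → Space D) : Finset ℝ :=
  (Finset.range n).image (mergeRadius x)

/-- `A` is bigger than `B`: more observations or, in the event of a tie, smaller first index. -/
def Bigger {n : ℕ} (A B : Finset (Fin n)) : Prop :=
  B.card < A.card ∨ (A.card = B.card ∧ A.min < B.min)

open scoped Classical in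
/-- The `m`-th biggest cluster of `𝒴(r)`, where `m` counts from `0`: the observations whose
cluster has exactly `m` bigger clusters. It is empty if there are at most `m` clusters. -/
def rankedCluster {D n : ℕ} (x : Fin n → Space D) (r : ℝ) (m : ℕ) : Finset (Fin n) :=
  Finset.univ.filter fun l => ((clusters x r).filter fun A => Bigger A (cluster x r l)).card = m

/-- The radius selected by OSL: the largest merging radius among those that maximize the size
of the `M`-th biggest cluster. -/
def selectedRadius {D n : ℕ} (M : ℕ) (x : Fin n → Space D) : ℝ :=
  sSup {ρ | ρ ∈ radii x ∧ ∀ ρ' ∈ radii x,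
    (rankedCluster x ρ' (M - 1)).card ≤ (rankedCluster x ρ (M - 1)).card}

/-- The OSL clusters `𝒳_1(r̂), …, 𝒳_M(r̂)`. -/
def oslCluster {D n : ℕ} (M : ℕ) (x : Fin n → Space D) (m : Fin M) : Finset (Fin n) :=
  rankedCluster x (selectedRadius M x) m

/-- The clustering risk of OSL: the probability that for no permutation `π` all observations in
`S_i` are in the cluster with index `π i`, for every `i`. -/
def risk {Ω : Type*} [MeasurableSpace Ω] (μ : Measure Ω) {D M n : ℕ}
    (P : Fin M → Measure (Space D)) (X : Fin n → Ω → Space D) : ℝ :=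
  μ.real {ω | ∀ π : Equiv.Perm (Fin M), ∃ i,
    ¬ ∀ k, X k ω ∈ (P i).support → k ∈ oslCluster M (fun k => X k ω) (π i)}

end OSL

end

/-!
The proof compares the selected radius with a radius `t` at which single linkage already works.

*Deterministic part* (`exists_perm_oslCluster`). Suppose that at radius `t` the observations of
each `S_i` lie in one cluster, that distinct `S_i` are in distinct clusters, and that the counts satisfy
`N₀ < N_i` and `N_i + N₀ < 2 N_j`, where `N₀` is the number of outliers. Some merging radius `ρ ≤ t`
has the same clusters as `t`. At the selected radius the `M`-th cluster is at least as big as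
`min N_j`, so each of the `M` biggest clusters meets some `S_i`. If the selected radius were smaller
than `ρ`, two of these clusters could not meet the same `S_i`, for they would both fit into a
cluster of size at most `N_i + N₀`; hence each of them is contained in its own cluster of radius `ρ`, `ρ`
is also a maximizer, and the choice of the largest maximizer is contradicted. So the selected radius
is at least `ρ`, every `S_i` is in a single cluster, and the `M` biggest clusters are those of the
`S_i`.

*Probabilistic part* (`risk_le`). Three events can spoil this.

* The counts deviate from their means. The assumption on `ε` leaves a slack in the two inequalities
  that does not depend on `ε` (`A6.slack`), so Hoeffding's inequality gives `exp (-c n)`.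
* Some `S_i` is not connected at radius `t`. Take a maximal packing of `S_i` by balls of radius
  `t / 6`. By the lower bounds on the measures these balls have mass at least of order `t ^ d`, so
  there are `O(t ^ (-d))` of them, and since `S_i` is connected, one observation in each ball is
  enough (`exists_packing`). The probability is `O(t ^ (-d) exp (-c n t ^ d))`.
* Outliers link two of the `S_i`. A shortest path between distinct `S_i` contains more than `m`
  distinct outliers in a chain with steps at most `t` as soon as `(m + 1) t < δ`
  (`exists_chain_of_reachable`), and such a chain exists with probability at most
  `n ε (K n ε t ^ D) ^ m` (`IsSample.measure_exists_chain_le`).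

With `t = τ / u` for a small constant `τ`, the third term is `O(exp (-u))` if `n ε ≤ u ^ D`, and it
is dominated by the second one if `n ≤ u ^ (d + 1)` (`exists_risk_le_of_scale`). All rates but the one
for few outliers follow from this, with `u = n ^ (1 / (d + 1))` or `u = n ^ ((1 - β) / D)`; for few
outliers, `t` is a constant and the absence of outliers suffices.
-/

namespace OSL

/-! ### Single linkage clusters as components of a graph -/

section Linkage

variable {D n : ℕ}

/-- The graph on the indices in which two observations are linked when they are at distance at
most `r`. -/
def linkGraph (x : Fin n → Space D) (r : ℝ) : SimpleGraph (Fin n) where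
  Adj a b := a ≠ b ∧ ‖x a - x b‖ ≤ r
  symm := ⟨fun a b h => ⟨h.1.symm, by rw [norm_sub_rev]; exact h.2⟩⟩
  loopless := ⟨fun a h => h.1 rfl⟩

theorem linkGraph_mono (x : Fin n → Space D) {r s : ℝ} (h : r ≤ s) :
    linkGraph x r ≤ linkGraph x s := fun _ _ hab => ⟨hab.1, hab.2.trans h⟩

theorem reachable_of_norm_le {x : Fin n → Space D} {r : ℝ} {a b : Fin n}
    (h : ‖x a - x b‖ ≤ r) : (linkGraph x r).Reachable a b := by
  by_cases hab : a = b
  · rw [hab]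
  · exact SimpleGraph.Adj.reachable (G := linkGraph x r) ⟨hab, h⟩

/-- Two observations are in the same component of the union of the balls of radius `r / 2` if and
only if a chain of observations with steps at most `r` joins them. -/
theorem mem_connectedComponentIn_iff_reachable (x : Fin n → Space D) {r : ℝ} (hr : 0 ≤ r)
    (k l : Fin n) :
    x l ∈ connectedComponentIn (⋃ m, Metric.closedBall (x m) (r / 2)) (x k) ↔
      (linkGraph x r).Reachable k l := by
  classical
  set F := ⋃ m, Metric.closedBall (x m) (r / 2) with hF
  have hmem : ∀ a, x a ∈ F := fun a =>
    Set.mem_iUnion.2 ⟨a, Metric.mem_closedBall_self (by positivity)⟩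
  constructor
  · intro hl
    by_contra hkl
    -- the balls around reachable observations and the other balls form two disjoint closed sets
    let U := ⋃ m ∈ {m | (linkGraph x r).Reachable k m}, Metric.closedBall (x m) (r / 2)
    let V := ⋃ m ∈ {m | ¬ (linkGraph x r).Reachable k m}, Metric.closedBall (x m) (r / 2)
    have hU : IsClosed U := Set.Finite.isClosed_biUnion (Set.toFinite _)
      fun _ _ => Metric.isClosed_closedBall
    have hV : IsClosed V := Set.Finite.isClosed_biUnion (Set.toFinite _)
      fun _ _ => Metric.isClosed_closedBall
    have hsub : connectedComponentIn F (x k) ⊆ U ∪ V := by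
      refine (connectedComponentIn_subset _ _).trans ?_
      rintro y hy
      obtain ⟨m, hm⟩ := Set.mem_iUnion.1 hy
      by_cases h : (linkGraph x r).Reachable k m
      · exact Or.inl (Set.mem_biUnion (x := m) h hm)
      · exact Or.inr (Set.mem_biUnion (x := m) h hm)
    obtain ⟨y, -, hyU, hyV⟩ := isPreconnected_closed_iff.1
      (isPreconnected_connectedComponentIn (F := F) (x := x k)) U V hU hV hsub
      ⟨x k, mem_connectedComponentIn (hmem k), Set.mem_biUnion (x := k)
        (show (linkGraph x r).Reachable k k from SimpleGraph.Reachable.refl k)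
        (Metric.mem_closedBall_self (by positivity))⟩
      ⟨x l, hl, Set.mem_biUnion (x := l) hkl (Metric.mem_closedBall_self (by positivity))⟩
    obtain ⟨a, ha, hya⟩ := Set.mem_iUnion₂.1 hyU
    obtain ⟨b, hb, hyb⟩ := Set.mem_iUnion₂.1 hyV
    refine hb (SimpleGraph.Reachable.trans ha (reachable_of_norm_le ?_))
    rw [← dist_eq_norm]
    rw [Metric.mem_closedBall] at hya hyb
    linarith [dist_triangle_left (x a) (x b) y]
  · rintro ⟨p⟩
    have key : ∀ a b, (linkGraph x r).Adj a b → x b ∈ connectedComponentIn F (x a) := by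
      intro a b hab
      have hs : segment ℝ (x a) (x b) ⊆ F := by
        intro y hy
        have hd := mem_segment_iff_wbtw.1 hy |>.dist_add_dist
        have h2 := hab.2
        rw [← dist_eq_norm] at h2
        rcases le_total (dist (x a) y) (dist y (x b)) with h | h
        · exact Set.mem_iUnion.2 ⟨a, by rw [Metric.mem_closedBall, dist_comm]; linarith⟩
        · exact Set.mem_iUnion.2 ⟨b, by rw [Metric.mem_closedBall]; linarith⟩
      exact (convex_segment _ _).isPreconnected.subset_connectedComponentIn
        (left_mem_segment _ _ _) hs (right_mem_segment _ _ _)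
    induction p with
    | nil => exact mem_connectedComponentIn (hmem _)
    | cons h p ih =>
      rw [connectedComponentIn_eq (key _ _ h)]
      exact ih

theorem mem_cluster_iff {x : Fin n → Space D} {r : ℝ} (hr : 0 ≤ r) {k l : Fin n} :
    l ∈ cluster x r k ↔ (linkGraph x r).Reachable k l := by
  classical
  simp only [cluster, Finset.mem_filter, Finset.mem_univ, true_and]
  exact mem_connectedComponentIn_iff_reachable x hr k l

theorem self_mem_cluster (x : Fin n → Space D) {r : ℝ} (hr : 0 ≤ r) (k : Fin n) :
    k ∈ cluster x r k := (mem_cluster_iff hr).2 (SimpleGraph.Reachable.refl k)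

theorem cluster_eq_of_mem {x : Fin n → Space D} {r : ℝ} (hr : 0 ≤ r) {k l : Fin n}
    (h : l ∈ cluster x r k) : cluster x r l = cluster x r k := by
  rw [mem_cluster_iff hr] at h
  ext a
  rw [mem_cluster_iff hr, mem_cluster_iff hr]
  exact ⟨h.trans, h.symm.trans⟩

theorem cluster_mem_clusters (x : Fin n → Space D) (r : ℝ) (k : Fin n) :
    cluster x r k ∈ clusters x r := Finset.mem_image_of_mem _ (Finset.mem_univ k)

theorem eq_cluster_of_mem {x : Fin n → Space D} {r : ℝ} (hr : 0 ≤ r) {A : Finset (Fin n)}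
    (hA : A ∈ clusters x r) {k : Fin n} (hk : k ∈ A) : A = cluster x r k := by
  obtain ⟨l, -, rfl⟩ := Finset.mem_image.1 hA
  exact (cluster_eq_of_mem hr hk).symm

theorem clusters_nonempty {x : Fin n → Space D} {r : ℝ} (hr : 0 ≤ r) {A : Finset (Fin n)}
    (hA : A ∈ clusters x r) : A.Nonempty := by
  obtain ⟨l, -, rfl⟩ := Finset.mem_image.1 hA
  exact ⟨l, self_mem_cluster x hr l⟩

theorem clusters_eq_of_not_disjoint {x : Fin n → Space D} {r : ℝ} (hr : 0 ≤ r)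
    {A B : Finset (Fin n)} (hA : A ∈ clusters x r) (hB : B ∈ clusters x r) {k : Fin n}
    (hkA : k ∈ A) (hkB : k ∈ B) : A = B :=
  (eq_cluster_of_mem hr hA hkA).trans (eq_cluster_of_mem hr hB hkB).symm

theorem cluster_mono {x : Fin n → Space D} {r s : ℝ} (hr : 0 ≤ r) (hrs : r ≤ s) (k : Fin n) :
    cluster x r k ⊆ cluster x s k := fun l hl => by
  rw [mem_cluster_iff (hr.trans hrs)]
  exact ((mem_cluster_iff hr).1 hl).mono (linkGraph_mono x hrs)

/-! ### Merging radii -/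

theorem mergeRadius_nonneg (x : Fin n → Space D) (k : ℕ) : 0 ≤ mergeRadius x k := by
  induction k with
  | zero => simp [mergeRadius]
  | succ k ih =>
    rw [mergeRadius]
    split_ifs
    · refine Real.sInf_nonneg ?_
      rintro t ⟨A, -, B, -, -, rfl⟩
      refine Real.sInf_nonneg ?_
      rintro t ⟨a, -, b, -, rfl⟩
      exact norm_nonneg _
    · exact ih

theorem finite_linkDist_set (x : Fin n → Space D) (A B : Finset (Fin n)) :
    {t | ∃ k ∈ A, ∃ l ∈ B, t = ‖x k - x l‖}.Finite := by
  refine (Set.finite_range fun p : Fin n × Fin n => ‖x p.1 - x p.2‖).subset ?_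
  rintro t ⟨a, -, b, -, rfl⟩
  exact ⟨(a, b), rfl⟩

theorem finite_clusterGap_set (x : Fin n → Space D) (r : ℝ) :
    {t | ∃ A ∈ clusters x r, ∃ B ∈ clusters x r, A ≠ B ∧ t = linkDist x A B}.Finite := by
  refine (Set.finite_range
    fun p : Finset (Fin n) × Finset (Fin n) => linkDist x p.1 p.2).subset ?_
  rintro t ⟨a, -, b, -, -, rfl⟩
  exact ⟨(a, b), rfl⟩

/-- The next merging radius is a distance between observations of different clusters. -/
theorem exists_norm_eq_mergeRadius_succ (x : Fin n → Space D) (k : ℕ)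
    (h : 2 ≤ (clusters x (mergeRadius x k)).card) :
    ∃ a b, cluster x (mergeRadius x k) a ≠ cluster x (mergeRadius x k) b ∧
      ‖x a - x b‖ = mergeRadius x (k + 1) := by
  have h0 := mergeRadius_nonneg x k
  obtain ⟨A, hA, B, hB, hAB⟩ := Finset.one_lt_card.1 h
  obtain ⟨A', hA', B', hB', hne, ht⟩ := Set.Nonempty.csInf_mem
    (s := {t | ∃ A ∈ clusters x (mergeRadius x k), ∃ B ∈ clusters x (mergeRadius x k),
        A ≠ B ∧ t = linkDist x A B}) ⟨_, A, hA, B, hB, hAB, rfl⟩ (finite_clusterGap_set x _)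
  obtain ⟨a, ha⟩ := clusters_nonempty h0 hA'
  obtain ⟨b, hb⟩ := clusters_nonempty h0 hB'
  obtain ⟨a', ha', b', hb', ht'⟩ := Set.Nonempty.csInf_mem
    (s := {t | ∃ k ∈ A', ∃ l ∈ B', t = ‖x k - x l‖}) ⟨_, a, ha, b, hb, rfl⟩
    (finite_linkDist_set x _ _)
  refine ⟨a', b', ?_, ?_⟩
  · rw [← eq_cluster_of_mem h0 hA' ha', ← eq_cluster_of_mem h0 hB' hb']
    exact hne
  · rw [mergeRadius, if_pos h, ht, linkDist, ht']

theorem mergeRadius_succ_le_norm (x : Fin n → Space D) (k : ℕ) {a b : Fin n}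
    (hab : cluster x (mergeRadius x k) a ≠ cluster x (mergeRadius x k) b) :
    mergeRadius x (k + 1) ≤ ‖x a - x b‖ := by
  have h0 := mergeRadius_nonneg x k
  have h : 2 ≤ (clusters x (mergeRadius x k)).card :=
    Finset.one_lt_card.2 ⟨_, cluster_mem_clusters x _ a, _, cluster_mem_clusters x _ b, hab⟩
  rw [mergeRadius, if_pos h]
  refine (csInf_le (finite_clusterGap_set x _).bddBelow
    ⟨_, cluster_mem_clusters x _ a, _, cluster_mem_clusters x _ b, hab, rfl⟩).trans ?_
  exact csInf_le (finite_linkDist_set x _ _).bddBelow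
    ⟨a, self_mem_cluster x h0 a, b, self_mem_cluster x h0 b, rfl⟩

theorem mergeRadius_lt_succ (x : Fin n → Space D) (k : ℕ)
    (h : 2 ≤ (clusters x (mergeRadius x k)).card) :
    mergeRadius x k < mergeRadius x (k + 1) := by
  obtain ⟨a, b, hab, he⟩ := exists_norm_eq_mergeRadius_succ x k h
  have h0 := mergeRadius_nonneg x k
  by_contra hlt
  refine hab (cluster_eq_of_mem h0 ((mem_cluster_iff h0).2 (reachable_of_norm_le ?_))).symm
  rw [he]
  exact not_lt.1 hlt

/-- Between two consecutive merging radii the clusters do not change. -/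
theorem cluster_eq_of_lt_mergeRadius_succ (x : Fin n → Space D) (k : ℕ) {t : ℝ}
    (hkt : mergeRadius x k ≤ t)
    (h : t < mergeRadius x (k + 1) ∨ (clusters x (mergeRadius x k)).card < 2) :
    cluster x t = cluster x (mergeRadius x k) := by
  have h0 := mergeRadius_nonneg x k
  have h0t := h0.trans hkt
  funext a
  refine Finset.Subset.antisymm ?_ (cluster_mono h0 hkt a)
  intro b hb
  rw [mem_cluster_iff h0t] at hb
  have key : ∀ c e, ‖x c - x e‖ ≤ t →
      cluster x (mergeRadius x k) c = cluster x (mergeRadius x k) e := by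
    intro c e hce
    by_contra hne
    rcases h with h | h
    · exact absurd (mergeRadius_succ_le_norm x k hne) (by linarith)
    · exact absurd (Finset.one_lt_card.2 ⟨_, cluster_mem_clusters x _ c, _,
        cluster_mem_clusters x _ e, hne⟩) (by omega)
  obtain ⟨p⟩ := hb
  induction p with
  | nil => exact self_mem_cluster x h0 _
  | cons h p ih => rw [key _ _ h.2]; exact ih

/-- Each merging step lowers the number of clusters. -/
theorem card_clusters_mergeRadius_succ_lt (x : Fin n → Space D) (k : ℕ)
    (h : 2 ≤ (clusters x (mergeRadius x k)).card) :
    (clusters x (mergeRadius x (k + 1))).card < (clusters x (mergeRadius x k)).card := by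
  classical
  have h0 := mergeRadius_nonneg x k
  have h1 := mergeRadius_nonneg x (k + 1)
  have hlt := mergeRadius_lt_succ x k h
  obtain ⟨a, b, hab, he⟩ := exists_norm_eq_mergeRadius_succ x k h
  set r := mergeRadius x k
  set s := mergeRadius x (k + 1)
  -- the map that sends a cluster to the larger cluster which contains it
  let g : Finset (Fin n) → Finset (Fin n) := fun A =>
    if hA : A.Nonempty then cluster x s hA.choose else ∅
  have hg : ∀ c, g (cluster x r c) = cluster x s c := by
    intro c
    have hA : (cluster x r c).Nonempty := ⟨c, self_mem_cluster x h0 c⟩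
    simp only [g, dif_pos hA]
    exact cluster_eq_of_mem h1 (cluster_mono h0 hlt.le c hA.choose_spec)
  have himg : clusters x s = (clusters x r).image g := by
    rw [clusters, clusters, Finset.image_image]
    exact Finset.image_congr fun c _ => (hg c).symm
  rw [himg]
  refine lt_of_le_of_ne Finset.card_image_le fun hcard => hab ?_
  refine Finset.card_image_iff.1 hcard (cluster_mem_clusters x r a) (cluster_mem_clusters x r b) ?_
  rw [hg, hg]
  exact (cluster_eq_of_mem h1 ((mem_cluster_iff h1).2 (reachable_of_norm_le he.le))).symm

/-- The clusters of any radius are the clusters of some merging radius below it. -/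
theorem exists_mem_radii_cluster_eq (hn : 0 < n) (x : Fin n → Space D) {t : ℝ} (ht : 0 ≤ t) :
    ∃ ρ ∈ radii x, 0 ≤ ρ ∧ ρ ≤ t ∧ cluster x t = cluster x ρ := by
  have key : ∀ k, (∃ j < k, mergeRadius x j ≤ t ∧ cluster x t = cluster x (mergeRadius x j)) ∨
      (mergeRadius x k ≤ t ∧ (clusters x (mergeRadius x k)).card + k ≤ n) := by
    intro k
    induction k with
    | zero =>
      refine Or.inr ⟨by simpa [mergeRadius] using ht, ?_⟩
      simpa [clusters] using Finset.card_image_le (s := Finset.univ)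
        (f := cluster x (mergeRadius x 0))
    | succ k ih =>
      rcases ih with ⟨j, hj, h⟩ | ⟨h1, h2⟩
      · exact Or.inl ⟨j, by omega, h⟩
      by_cases hc : 2 ≤ (clusters x (mergeRadius x k)).card
      · by_cases hs : mergeRadius x (k + 1) ≤ t
        · have := card_clusters_mergeRadius_succ_lt x k hc
          exact Or.inr ⟨hs, by omega⟩
        · exact Or.inl ⟨k, by omega, h1,
            cluster_eq_of_lt_mergeRadius_succ x k h1 (Or.inl (not_le.1 hs))⟩
      · exact Or.inl ⟨k, by omega, h1,
          cluster_eq_of_lt_mergeRadius_succ x k h1 (Or.inr (not_le.1 hc))⟩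
  rcases key n with ⟨j, hj, h1, h2⟩ | ⟨-, h2⟩
  · exact ⟨_, Finset.mem_image_of_mem _ (Finset.mem_range.2 hj), mergeRadius_nonneg x j, h1, h2⟩
  · have := Finset.card_pos.2 ⟨_, cluster_mem_clusters x (mergeRadius x n) ⟨0, hn⟩⟩
    omega

theorem radii_nonneg {x : Fin n → Space D} {ρ : ℝ} (h : ρ ∈ radii x) : 0 ≤ ρ := by
  obtain ⟨k, -, rfl⟩ := Finset.mem_image.1 h
  exact mergeRadius_nonneg x k

/-- The selected radius is a merging radius, it maximizes the size of the `M`-th cluster, and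
it is the largest radius that does. -/
theorem selectedRadius_spec (hn : 0 < n) (M : ℕ) (x : Fin n → Space D) :
    selectedRadius M x ∈ radii x ∧
    (∀ ρ ∈ radii x, (rankedCluster x ρ (M - 1)).card ≤
      (rankedCluster x (selectedRadius M x) (M - 1)).card) ∧
    ∀ ρ ∈ radii x, (rankedCluster x (selectedRadius M x) (M - 1)).card ≤
      (rankedCluster x ρ (M - 1)).card → ρ ≤ selectedRadius M x := by
  set T := {ρ | ρ ∈ radii x ∧ ∀ ρ' ∈ radii x,
    (rankedCluster x ρ' (M - 1)).card ≤ (rankedCluster x ρ (M - 1)).card} with hT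
  have hfin : T.Finite := (radii x).finite_toSet.subset fun ρ h => h.1
  have hne : T.Nonempty := by
    obtain ⟨ρ, h1, h2⟩ := Finset.exists_max_image (radii x)
      (fun ρ => (rankedCluster x ρ (M - 1)).card)
      ⟨_, Finset.mem_image_of_mem _ (Finset.mem_range.2 hn)⟩
    exact ⟨ρ, h1, h2⟩
  have hsel : selectedRadius M x ∈ T := hne.csSup_mem hfin
  exact ⟨hsel.1, hsel.2, fun ρ h1 h2 =>
    le_csSup hfin.bddAbove ⟨h1, fun ρ' h' => (hsel.2 ρ' h').trans h2⟩⟩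

/-! ### Ranks of clusters -/

theorem Bigger.trans {A B C : Finset (Fin n)} (h₁ : Bigger A B) (h₂ : Bigger B C) :
    Bigger A C := by
  rcases h₁ with h₁ | ⟨h₁, h₁'⟩ <;> rcases h₂ with h₂ | ⟨h₂, h₂'⟩
  · exact Or.inl (h₂.trans h₁)
  · exact Or.inl (h₂ ▸ h₁)
  · exact Or.inl (h₁ ▸ h₂)
  · exact Or.inr ⟨h₁.trans h₂, h₁'.trans h₂'⟩

theorem not_bigger_self (A : Finset (Fin n)) : ¬ Bigger A A := by
  rintro (h | ⟨-, h⟩)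
  · exact lt_irrefl _ h
  · exact lt_irrefl _ h

theorem Bigger.card_le {A B : Finset (Fin n)} (h : Bigger A B) : B.card ≤ A.card := by
  rcases h with h | h
  · exact h.le
  · exact h.1.ge

open scoped Classical in
/-- The number of clusters that are bigger than `A`. -/
noncomputable def rank (x : Fin n → Space D) (r : ℝ) (A : Finset (Fin n)) : ℕ :=
  ((clusters x r).filter fun B => Bigger B A).card

theorem bigger_or_bigger {x : Fin n → Space D} {r : ℝ} (hr : 0 ≤ r) {A B : Finset (Fin n)}
    (hA : A ∈ clusters x r) (hB : B ∈ clusters x r) (hne : A ≠ B) :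
    Bigger A B ∨ Bigger B A := by
  rcases lt_trichotomy A.card B.card with h | h | h
  · exact Or.inr (Or.inl h)
  · have hmin : A.min ≠ B.min := by
      intro hm
      obtain ⟨a, ha⟩ := Finset.min_of_nonempty (clusters_nonempty hr hA)
      exact hne (clusters_eq_of_not_disjoint hr hA hB (Finset.mem_of_min ha)
        (Finset.mem_of_min (hm ▸ ha)))
    rcases lt_or_gt_of_ne hmin with h' | h'
    · exact Or.inl (Or.inr ⟨h, h'⟩)
    · exact Or.inr (Or.inr ⟨h.symm, h'⟩)
  · exact Or.inl (Or.inl h)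

theorem rank_lt_of_bigger {x : Fin n → Space D} {r : ℝ} {A B : Finset (Fin n)}
    (hA : A ∈ clusters x r) (h : Bigger A B) : rank x r A < rank x r B := by
  classical
  refine Finset.card_lt_card ⟨?_, fun hsub => ?_⟩
  · intro C hC
    rw [Finset.mem_filter] at hC ⊢
    exact ⟨hC.1, hC.2.trans h⟩
  · exact not_bigger_self A (Finset.mem_filter.1 (hsub (Finset.mem_filter.2 ⟨hA, h⟩))).2

theorem rank_injOn {x : Fin n → Space D} {r : ℝ} (hr : 0 ≤ r) :
    Set.InjOn (rank x r) (clusters x r) := by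
  intro A hA B hB h
  by_contra hne
  rcases bigger_or_bigger hr hA hB hne with h' | h'
  · exact (rank_lt_of_bigger hA h').ne h
  · exact (rank_lt_of_bigger hB h').ne' h

theorem mem_rankedCluster {x : Fin n → Space D} {r : ℝ} {m : ℕ} {l : Fin n} :
    l ∈ rankedCluster x r m ↔ rank x r (cluster x r l) = m := by
  classical
  simp [rankedCluster, rank]

theorem rankedCluster_rank {x : Fin n → Space D} {r : ℝ} (hr : 0 ≤ r) {A : Finset (Fin n)}
    (hA : A ∈ clusters x r) : rankedCluster x r (rank x r A) = A := by
  ext l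
  rw [mem_rankedCluster]
  constructor
  · intro h
    rw [← rank_injOn hr (cluster_mem_clusters x r l) hA h]
    exact self_mem_cluster x hr l
  · intro h
    rw [← eq_cluster_of_mem hr hA h]

open scoped Classical in
/-- The `M` biggest clusters. -/
noncomputable def topClusters (x : Fin n → Space D) (r : ℝ) (M : ℕ) : Finset (Finset (Fin n)) :=
  (clusters x r).filter fun A => rank x r A < M

/-- If the `M`-th biggest cluster is not empty, there are `M` biggest clusters, and none of them
is smaller than it. -/
theorem topClusters_spec {x : Fin n → Space D} {r : ℝ} (hr : 0 ≤ r) {M : ℕ} (hM : 0 < M)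
    (h : 0 < (rankedCluster x r (M - 1)).card) :
    (topClusters x r M).card = M ∧
      ∀ A ∈ topClusters x r M, (rankedCluster x r (M - 1)).card ≤ A.card := by
  classical
  obtain ⟨l, hl⟩ := Finset.card_pos.1 h
  rw [mem_rankedCluster] at hl
  set B := cluster x r l with hB
  have hBm : B ∈ clusters x r := cluster_mem_clusters x r l
  have htop : topClusters x r M = insert B ((clusters x r).filter fun A => Bigger A B) := by
    ext A
    simp only [topClusters, Finset.mem_filter, Finset.mem_insert]
    constructor
    · rintro ⟨hA, hlt⟩
      by_cases hAB : A = B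
      · exact Or.inl hAB
      refine Or.inr ⟨hA, ?_⟩
      rcases bigger_or_bigger hr hA hBm hAB with h' | h'
      · exact h'
      · have := rank_lt_of_bigger hBm h'
        omega
    · rintro (rfl | ⟨hA, hAB⟩)
      · exact ⟨hBm, by omega⟩
      · have := rank_lt_of_bigger hA hAB
        exact ⟨hA, by omega⟩
  rw [htop, ← hl, rankedCluster_rank hr hBm]
  constructor
  · have hnot : B ∉ (clusters x r).filter fun A => Bigger A B := fun h' =>
      not_bigger_self B (Finset.mem_filter.1 h').2
    rw [Finset.card_insert_of_notMem hnot]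
    change rank x r B + 1 = M
    omega
  · intro A hA
    rcases Finset.mem_insert.1 hA with rfl | hA
    · exact le_rfl
    · exact (Finset.mem_filter.1 hA).2.card_le

/-- If there are `M` clusters with at least `s` observations, the `M`-th biggest cluster has at
least `s` observations. -/
theorem le_card_rankedCluster {x : Fin n → Space D} {r : ℝ} (hr : 0 ≤ r) {M s : ℕ}
    (hM : 0 < M) (C : Fin M → Finset (Fin n)) (hC : ∀ i, C i ∈ clusters x r)
    (hinj : Function.Injective C) (hs : ∀ i, s ≤ (C i).card) :
    s ≤ (rankedCluster x r (M - 1)).card := by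
  classical
  have himg : (Finset.univ.image C).card = M := by
    rw [Finset.card_image_of_injective _ hinj, Finset.card_fin]
  have hMle : M ≤ (clusters x r).card := by
    rw [← himg]
    exact Finset.card_le_card fun A hA => by
      obtain ⟨i, -, rfl⟩ := Finset.mem_image.1 hA
      exact hC i
  -- the ranks of the clusters are the numbers below the number of clusters
  have hrange : (clusters x r).image (rank x r) = Finset.range (clusters x r).card := by
    refine Finset.eq_of_subset_of_card_le ?_ ?_
    · intro m hm
      obtain ⟨A, hA, rfl⟩ := Finset.mem_image.1 hm
      refine Finset.mem_range.2 (Finset.card_lt_card ⟨Finset.filter_subset _ _, fun hsub => ?_⟩)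
      exact not_bigger_self A (Finset.mem_filter.1 (hsub hA)).2
    · rw [Finset.card_range, Finset.card_image_of_injOn (rank_injOn hr)]
  obtain ⟨A, hA, hrank⟩ := Finset.mem_image.1
    (hrange ▸ Finset.mem_range.2 (show M - 1 < (clusters x r).card by omega))
  rw [← hrank, rankedCluster_rank hr hA]
  by_contra hlt
  push Not at hlt
  have : (Finset.univ.image C).card ≤ rank x r A := by
    refine Finset.card_le_card fun B hB => ?_
    obtain ⟨i, -, rfl⟩ := Finset.mem_image.1 hB
    exact Finset.mem_filter.2 ⟨hC i, Or.inl (hlt.trans_le (hs i))⟩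
  omega

/-! ### Correctness of the selected clusters -/

/-- If single linkage with some radius separates the groups `I i` and the groups are large compared
with the number of remaining observations, then the selected clusters are correct. -/
theorem exists_perm_oslCluster {M : ℕ} (hM : 0 < M) (x : Fin n → Space D)
    (I : Fin M → Finset (Fin n)) (J : Finset (Fin n)) {t : ℝ} (ht : 0 ≤ t)
    (hcover : ∀ k, k ∈ J ∨ ∃ i, k ∈ I i)
    (hJ : ∀ i, J.card < (I i).card)
    (hIJ : ∀ i j, (I i).card + J.card < 2 * (I j).card)
    (hconn : ∀ i, ∀ k ∈ I i, ∀ l ∈ I i, (linkGraph x t).Reachable k l)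
    (hsep : ∀ i j, i ≠ j → ∀ k ∈ I i, ∀ l ∈ I j, ¬ (linkGraph x t).Reachable k l) :
    ∃ π : Equiv.Perm (Fin M), ∀ i, ∀ k ∈ I i, k ∈ oslCluster M x (π i) := by
  classical
  have hne : ∀ i, (I i).Nonempty := fun i => Finset.card_pos.1 ((Nat.zero_le _).trans_lt (hJ i))
  choose c hc using hne
  have hn : 0 < n := (c ⟨0, hM⟩).pos
  obtain ⟨ρ, hρ, h0, hρt, hcl⟩ := exists_mem_radii_cluster_eq hn x ht
  obtain ⟨hsel, hmax, hlast⟩ := selectedRadius_spec hn M x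
  set R := selectedRadius M x with hR
  have hR0 : 0 ≤ R := radii_nonneg hsel
  -- the clusters of the groups at the good radius `ρ`
  let C : Fin M → Finset (Fin n) := fun i => cluster x ρ (c i)
  have hmemC : ∀ i k, k ∈ C i ↔ (linkGraph x t).Reachable (c i) k := fun i k => by
    rw [← mem_cluster_iff ht, hcl]
  have hIC : ∀ i, I i ⊆ C i := fun i k hk => (hmemC i k).2 (hconn i _ (hc i) k hk)
  have hCI : ∀ i, C i ⊆ I i ∪ J := by
    intro i k hk
    rcases hcover k with h | ⟨j, hj⟩
    · exact Finset.mem_union_right _ h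
    · by_cases hij : i = j
      · exact Finset.mem_union_left _ (hij ▸ hj)
      · exact absurd ((hmemC i k).1 hk) (hsep i j hij _ (hc i) k hj)
  have hCinj : Function.Injective C := by
    intro i j hij
    by_contra hne
    exact hsep i j hne _ (hc i) _ (hc j) ((hmemC i _).1 (hij ▸ hIC j (hc j)))
  obtain ⟨i₀, -, hi₀⟩ := Finset.exists_min_image Finset.univ (fun i => (I i).card)
    ⟨⟨0, hM⟩, Finset.mem_univ _⟩
  have hgood : (I i₀).card ≤ (rankedCluster x ρ (M - 1)).card :=
    le_card_rankedCluster h0 hM C (fun i => cluster_mem_clusters x ρ _) hCinj fun i =>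
      (hi₀ i (Finset.mem_univ _)).trans (Finset.card_le_card (hIC i))
  have hRbig : (I i₀).card ≤ (rankedCluster x R (M - 1)).card := hgood.trans (hmax ρ hρ)
  have hRpos : 0 < (rankedCluster x R (M - 1)).card :=
    ((Nat.zero_le _).trans_lt (hJ i₀)).trans_le hRbig
  obtain ⟨htop, htopc⟩ := topClusters_spec hR0 hM hRpos
  -- every top cluster at the selected radius meets a group
  have hmeet : ∀ A : topClusters x R M, ∃ i, ∃ k ∈ A.1, k ∈ I i := by
    rintro ⟨A, hA⟩
    by_contra hno
    push Not at hno
    have hAJ : A ⊆ J := fun k hk => (hcover k).resolve_right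
      fun ⟨i, hi⟩ => hno i k hk hi
    have := Finset.card_le_card hAJ
    have := htopc A hA
    have := hJ i₀
    omega
  choose f g hgA hgI using hmeet
  have hAcl : ∀ A : topClusters x R M, A.1 = cluster x R (g A) := fun A =>
    eq_cluster_of_mem hR0 (Finset.mem_filter.1 A.2).1 (hgA A)
  have hcardA : Fintype.card (topClusters x R M) = Fintype.card (Fin M) := by
    rw [Fintype.card_coe, htop, Fintype.card_fin]
  have hρR : ρ ≤ R := by
    by_contra hlt
    push Not at hlt
    have hAC : ∀ A : topClusters x R M, A.1 ⊆ C (f A) := by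
      intro A k hk
      rw [hAcl A] at hk
      rw [← show cluster x ρ (g A) = C (f A) from cluster_eq_of_mem h0 (hIC _ (hgI A))]
      exact cluster_mono hR0 hlt.le _ hk
    have hfinj : Function.Injective f := by
      intro A B hAB
      by_contra hne
      have hdisj : Disjoint A.1 B.1 := Finset.disjoint_left.2 fun k hkA hkB =>
        hne (Subtype.ext (clusters_eq_of_not_disjoint hR0 (Finset.mem_filter.1 A.2).1
          (Finset.mem_filter.1 B.2).1 hkA hkB))
      have h1 := Finset.card_le_card (Finset.union_subset (hAC A) (hAB ▸ hAC B))
      rw [Finset.card_union_of_disjoint hdisj] at h1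
      have h2 := Finset.card_le_card (hCI (f A))
      have h3 := Finset.card_union_le (I (f A)) J
      have h4 := htopc A.1 A.2
      have h5 := htopc B.1 B.2
      have h6 := hIJ (f A) i₀
      omega
    have hfsurj : Function.Surjective f :=
      ((Fintype.bijective_iff_injective_and_card f).2 ⟨hfinj, hcardA⟩).2
    refine absurd (hlast ρ hρ ?_) (not_le.2 hlt)
    refine le_card_rankedCluster h0 hM C (fun i => cluster_mem_clusters x ρ _) hCinj fun i => ?_
    obtain ⟨A, rfl⟩ := hfsurj i
    exact (htopc A.1 A.2).trans (Finset.card_le_card (hAC A))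
  -- above the good radius each group lies in one cluster
  have hID : ∀ i, ∀ k ∈ I i, k ∈ cluster x R (c i) := fun i k hk =>
    cluster_mono h0 hρR _ (hIC i hk)
  have hAD : ∀ A : topClusters x R M, A.1 = cluster x R (c (f A)) := fun A => by
    rw [hAcl A]
    exact cluster_eq_of_mem hR0 (hID _ _ (hgI A))
  have hfinj : Function.Injective f := fun A B hAB =>
    Subtype.ext (by rw [hAD A, hAD B, hAB])
  let e : topClusters x R M ≃ Fin M := Equiv.ofBijective f
    ((Fintype.bijective_iff_injective_and_card f).2 ⟨hfinj, hcardA⟩)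
  let rk : topClusters x R M → Fin M := fun A => ⟨rank x R A.1, (Finset.mem_filter.1 A.2).2⟩
  have hrk : Function.Injective rk := fun A B hAB => Subtype.ext
    (rank_injOn hR0 (Finset.mem_filter.1 A.2).1 (Finset.mem_filter.1 B.2).1
      (Fin.mk.inj_iff.1 hAB))
  let e' : topClusters x R M ≃ Fin M := Equiv.ofBijective rk
    ((Fintype.bijective_iff_injective_and_card rk).2 ⟨hrk, hcardA⟩)
  refine ⟨e.symm.trans e', fun i k hk => ?_⟩
  have hfi : f (e.symm i) = i := e.apply_symm_apply i
  change k ∈ rankedCluster x R (rank x R (e.symm i).1)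
  rw [rankedCluster_rank hR0 (Finset.mem_filter.1 (e.symm i).2).1, hAD, hfi]
  exact hID i k hk

end Linkage

/-! ### Chains of outliers -/

/-- The sequences of `m + 1` points of `A` in which consecutive points are at distance at
most `t`. -/
def chainSet {D : ℕ} (A : Set (Space D)) (t : ℝ) (m : ℕ) : Set (Fin (m + 1) → Space D) :=
  {y | (∀ s, y s ∈ A) ∧ ∀ s : Fin m, ‖y s.castSucc - y s.succ‖ ≤ t}

theorem norm_sub_le_length_mul {D n : ℕ} {x : Fin n → Space D} {t : ℝ} {k l : Fin n}
    (p : (linkGraph x t).Walk k l) : ‖x k - x l‖ ≤ p.length * t := by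
  induction p with
  | nil => simp
  | @cons u v w h p ih =>
    rw [SimpleGraph.Walk.length_cons]
    push_cast
    have := h.2
    linarith [norm_sub_le_norm_sub_add_norm_sub (x u) (x v) (x w)]

/-- If observations of two distant groups are linked, a shortest path between distinct groups
contains a chain of distinct observations outside the groups. -/
theorem exists_chain_of_reachable {D n M m : ℕ} {x : Fin n → Space D} {t δ : ℝ}
    (S : Fin M → Set (Space D)) (hm : (m + 1) * t < δ) (ht : 0 ≤ t)
    (hδ : ∀ i j, i ≠ j → ∀ y ∈ S i, ∀ z ∈ S j, δ ≤ ‖y - z‖)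
    (h : ∃ i j, i ≠ j ∧ ∃ k l, x k ∈ S i ∧ x l ∈ S j ∧ (linkGraph x t).Reachable k l) :
    ∃ f : Fin (m + 1) → Fin n, Function.Injective f ∧ (fun s => x (f s)) ∈
      chainSet (⋃ i, S i)ᶜ t m := by
  classical
  have hex : ∃ L : ℕ, ∃ i j, i ≠ j ∧ ∃ k l, x k ∈ S i ∧ x l ∈ S j ∧
      ∃ p : (linkGraph x t).Walk k l, p.length = L := by
    obtain ⟨i, j, hij, k, l, hk, hl, ⟨p⟩⟩ := h
    exact ⟨_, i, j, hij, k, l, hk, hl, p, rfl⟩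
  obtain ⟨i, j, hij, k, l, hk, hl, p, hp⟩ := Nat.find_spec hex
  have hmin := fun {L : ℕ} (hL : L < Nat.find hex) => Nat.find_min hex hL
  have hpath : p.IsPath := by
    refine p.isPath_of_length_eq_dist (le_antisymm ?_ (SimpleGraph.dist_le p))
    by_contra hlt
    push Not at hlt
    obtain ⟨q, hq⟩ := (SimpleGraph.Walk.reachable p).exists_walk_length_eq_dist
    exact hmin (L := q.length) (by omega) ⟨i, j, hij, k, l, hk, hl, q, rfl⟩
  have hlen : m + 1 < p.length := by
    by_contra hle
    push Not at hle
    have h1 := (hδ i j hij _ hk _ hl).trans (norm_sub_le_length_mul p)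
    have h2 : (p.length : ℝ) ≤ m + 1 := by exact_mod_cast hle
    nlinarith [mul_le_mul_of_nonneg_right h2 ht]
  refine ⟨fun s => p.getVert (s + 1), ?_, ?_, ?_⟩
  · intro a b hab
    have := hpath.getVert_injOn (x₁ := (a : ℕ) + 1) (x₂ := (b : ℕ) + 1)
      (show (a : ℕ) + 1 ≤ p.length by omega) (show (b : ℕ) + 1 ≤ p.length by omega) hab
    exact Fin.ext (by omega)
  · -- an inner vertex in a group would give a shorter walk between distinct groups
    intro s hs
    obtain ⟨i', hi'⟩ := Set.mem_iUnion.1 hs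
    by_cases h' : i = i'
    · refine hmin (L := (p.drop (s + 1)).length) ?_
        ⟨i', j, h' ▸ hij, _, l, hi', hl, p.drop (s + 1), rfl⟩
      rw [SimpleGraph.Walk.drop_length]
      omega
    · refine hmin (L := (p.take (s + 1)).length) ?_
        ⟨i, i', h', k, _, hk, hi', p.take (s + 1), rfl⟩
      rw [SimpleGraph.Walk.take_length]
      omega
  · intro s
    exact (p.adj_getVert_succ (i := (s : ℕ) + 1) (by omega)).2

theorem measurableSet_chainSet {D : ℕ} {A : Set (Space D)} (hA : MeasurableSet A) (t : ℝ)
    (m : ℕ) : MeasurableSet (chainSet A t m) := by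
  have : chainSet A t m = (⋂ s, Function.eval s ⁻¹' A) ∩
      ⋂ s : Fin m, {y | ‖y s.castSucc - y s.succ‖ ≤ t} := by
    ext y
    simp [chainSet]
  rw [this]
  refine (MeasurableSet.iInter fun s => measurable_pi_apply s hA).inter
    (MeasurableSet.iInter fun s => measurableSet_le (Measurable.norm ?_) measurable_const)
  exact (measurable_pi_apply _).sub (measurable_pi_apply _)

/-- Independent points form a chain with a probability that decays geometrically in its
length, provided that balls have small mass. -/
theorem pi_chainSet_le {D : ℕ} (ν : Measure (Space D)) [IsProbabilityMeasure ν]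
    {A : Set (Space D)} (hA : MeasurableSet A) (t : ℝ) (q : ENNReal)
    (hq : ∀ z, ν (A ∩ Metric.closedBall z t) ≤ q) (m : ℕ) :
    Measure.pi (fun _ : Fin (m + 1) => ν) (chainSet A t m) ≤ ν A * q ^ m := by
  induction m with
  | zero =>
    have : chainSet A t 0 = Function.eval 0 ⁻¹' A := by
      ext y
      simp [chainSet]
    rw [this, (measurePreserving_eval (fun _ : Fin 1 => ν) 0).measure_preimage
      hA.nullMeasurableSet]
    simp
  | succ m ih =>
    let T : Set (Space D × (Fin (m + 1) → Space D)) :=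
      {p | p.1 ∈ A ∧ ‖p.1 - p.2 0‖ ≤ t ∧ p.2 ∈ chainSet A t m}
    have hT : MeasurableSet T := by
      refine MeasurableSet.inter (measurable_fst hA) (MeasurableSet.inter ?_
        (measurable_snd (measurableSet_chainSet hA t m)))
      refine measurableSet_le (Measurable.norm ?_) measurable_const
      exact measurable_fst.sub ((measurable_pi_apply 0).comp measurable_snd)
    have hpre : chainSet A t (m + 1) =
        MeasurableEquiv.piFinSuccAbove (fun _ : Fin (m + 2) => Space D) 0 ⁻¹' T := by
      ext y
      simp only [chainSet, T, Set.mem_preimage, Set.mem_ofPred_eq,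
        MeasurableEquiv.piFinSuccAbove_apply, Fin.insertNthEquiv_symm_apply, Fin.removeNth,
        Fin.forall_fin_succ (n := m + 1), Fin.forall_fin_succ (n := m), Fin.succAbove_zero]
      simp only [Fin.castSucc_zero, Fin.succ_zero_eq_one, Fin.castSucc_succ]
      tauto
    rw [hpre, (measurePreserving_piFinSuccAbove (fun _ : Fin (m + 2) => ν) 0).measure_preimage
      hT.nullMeasurableSet, Measure.prod_apply_symm hT]
    calc ∫⁻ y, ν ((fun x => (x, y)) ⁻¹' T) ∂(Measure.pi fun _ : Fin (m + 1) => ν)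
        ≤ ∫⁻ y, (chainSet A t m).indicator (fun _ => q) y
            ∂(Measure.pi fun _ : Fin (m + 1) => ν) := by
          refine lintegral_mono fun y => ?_
          by_cases hy : y ∈ chainSet A t m
          · rw [Set.indicator_of_mem hy]
            refine (measure_mono ?_).trans (hq (y 0))
            rintro z ⟨hz, hzt, -⟩
            exact ⟨hz, by rwa [Metric.mem_closedBall, dist_eq_norm]⟩
          · rw [Set.indicator_of_notMem hy]
            have : (fun x => (x, y)) ⁻¹' T = ∅ := by
              ext z
              simp [T, hy]
            rw [this, measure_empty]
      _ = q * Measure.pi (fun _ : Fin (m + 1) => ν) (chainSet A t m) := by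
          rw [lintegral_indicator (measurableSet_chainSet hA t m), setLIntegral_const]
      _ ≤ q * (ν A * q ^ m) := by gcongr
      _ = ν A * q ^ (m + 1) := by ring

section Sample

variable {Ω : Type*} [MeasurableSpace Ω] {μ : Measure Ω} {D n : ℕ}
  {X : Fin n → Ω → Space D} {ν : Measure (Space D)}

theorem IsSample.measure_exists_chain_le [IsProbabilityMeasure μ] [IsProbabilityMeasure ν]
    (hX : IsSample μ X ν)
    {A : Set (Space D)} (hA : MeasurableSet A) (t : ℝ) (q : ENNReal)
    (hq : ∀ z, ν (A ∩ Metric.closedBall z t) ≤ q) (m : ℕ) :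
    μ {ω | ∃ f : Fin (m + 1) → Fin n, Function.Injective f ∧
      (fun s => X (f s) ω) ∈ chainSet A t m} ≤ n ^ (m + 1) * (ν A * q ^ m) := by
  have hone : ∀ f : Fin (m + 1) → Fin n, μ {ω | Function.Injective f ∧
      (fun s => X (f s) ω) ∈ chainSet A t m} ≤ ν A * q ^ m := by
    intro f
    by_cases hf : Function.Injective f
    · simp only [hf, true_and]
      have hind : iIndepFun (fun s => X (f s)) μ := hX.indep.precomp hf
      have hmap := (iIndepFun_iff_map_fun_eq_pi_map
        fun s => (hX.measurable (f s)).aemeasurable).1 hind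
      simp only [hX.law] at hmap
      have hmeas : Measurable fun ω (s : Fin (m + 1)) => X (f s) ω :=
        measurable_pi_lambda _ fun s => hX.measurable (f s)
      have := pi_chainSet_le ν hA t q hq m
      rw [← hmap, Measure.map_apply hmeas (measurableSet_chainSet hA t m)] at this
      exact this
    · simp [hf]
  rw [Set.ofPred_exists]
  refine (measure_iUnion_fintype_le μ _).trans ((Finset.sum_le_sum fun f _ => hone f).trans ?_)
  simp

/-! ### Concentration of the numbers of observations -/

theorem IsSample.integral_comp (hX : IsSample μ X ν) {g : Space D → ℝ} (hg : Measurable g)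
    (k : Fin n) : ∫ ω, g (X k ω) ∂μ = ∫ z, g z ∂ν := by
  rw [← hX.law k, integral_map (hX.measurable k).aemeasurable hg.aestronglyMeasurable]

/-- Hoeffding's inequality for a function with values in `[0, 1]`. -/
theorem IsSample.measure_sum_deviation_le [IsProbabilityMeasure μ] (hX : IsSample μ X ν)
    {g : Space D → ℝ} (hg : Measurable g) (hg01 : ∀ z, g z ∈ Set.Icc (0 : ℝ) 1) {α : ℝ} (hα : 0 ≤ α) :
    μ.real {ω | α * n ≤ ∑ k, (g (X k ω) - ∫ z, g z ∂ν)} ≤ Real.exp (-2 * α ^ 2 * n) := by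
  have hind : iIndepFun (fun k ω => g (X k ω) - ∫ z, g z ∂ν) μ :=
    hX.indep.comp (fun _ z => g z - ∫ z, g z ∂ν) fun _ => by fun_prop
  have hsub : ∀ k ∈ Finset.univ, HasSubgaussianMGF (fun ω => g (X k ω) - ∫ z, g z ∂ν)
      ((‖(1 : ℝ) - 0‖₊ / 2) ^ 2) μ := by
    intro k _
    have := hasSubgaussianMGF_of_mem_Icc (μ := μ) (X := fun ω => g (X k ω)) (a := 0) (b := 1)
      (hg.comp (hX.measurable k)).aemeasurable (Filter.Eventually.of_forall fun ω => hg01 _)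
    rwa [hX.integral_comp hg k] at this
  refine (HasSubgaussianMGF.measure_sum_ge_le_of_iIndepFun hind hsub
    (by positivity : (0 : ℝ) ≤ α * n)).trans (Real.exp_le_exp.2 (le_of_eq ?_))
  rcases Nat.eq_zero_or_pos n with rfl | hn
  · simp
  · have : (n : ℝ) ≠ 0 := by positivity
    simp
    field_simp

open scoped Classical in
/-- The indices of the observations in `A`. -/
noncomputable def indices (x : Fin n → Space D) (A : Set (Space D)) : Finset (Fin n) :=
  Finset.univ.filter fun k => x k ∈ A

theorem mem_indices {x : Fin n → Space D} {A : Set (Space D)} {k : Fin n} :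
    k ∈ indices x A ↔ x k ∈ A := by
  classical
  simp [indices]

theorem IsSample.measure_card_deviation_le [IsProbabilityMeasure μ] [IsProbabilityMeasure ν]
    (hX : IsSample μ X ν)
    {A : Set (Space D)} (hA : MeasurableSet A) {α : ℝ} (hα : 0 ≤ α) :
    μ.real {ω | α * n ≤ |((indices (fun k => X k ω) A).card : ℝ) - n * ν.real A|} ≤
      2 * Real.exp (-2 * α ^ 2 * n) := by
  classical
  have hsum : ∀ ω, ((indices (fun k => X k ω) A).card : ℝ) =
      ∑ k, A.indicator (fun _ => (1 : ℝ)) (X k ω) := by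
    intro ω
    simp [indices, Set.indicator_apply]
  have h1 := hX.measure_sum_deviation_le (g := A.indicator fun _ => (1 : ℝ))
    (measurable_const.indicator hA)
    (fun z => by by_cases hz : z ∈ A <;> simp [hz]) hα
  have h2 := hX.measure_sum_deviation_le (g := Aᶜ.indicator fun _ => (1 : ℝ))
    (measurable_const.indicator hA.compl)
    (fun z => by by_cases hz : z ∈ A <;> simp [hz]) hα
  rw [two_mul]
  refine (measureReal_mono ?_).trans ((measureReal_union_le _ _).trans (add_le_add h1 h2))
  intro ω hω
  simp only [Set.mem_ofPred_eq, hsum] at hω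
  have hc : ∀ z, Aᶜ.indicator (fun _ => (1 : ℝ)) z = 1 - A.indicator (fun _ => (1 : ℝ)) z :=
    fun z => by by_cases hz : z ∈ A <;> simp [hz]
  have hi1 : ∫ z, A.indicator (fun _ => (1 : ℝ)) z ∂ν = ν.real A := by
    rw [integral_indicator hA]; simp
  have hi2 : ∫ z, Aᶜ.indicator (fun _ => (1 : ℝ)) z ∂ν = 1 - ν.real A := by
    rw [integral_indicator hA.compl]; simp [probReal_compl_eq_one_sub hA]
  rcases le_abs'.1 hω with h | h
  · right
    simp only [Set.mem_ofPred_eq, hi2]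
    simp only [hc, Finset.sum_sub_distrib, Finset.sum_const,
      Finset.card_univ, Fintype.card_fin, nsmul_eq_mul]
    linarith
  · left
    simp only [Set.mem_ofPred_eq, hi1, Finset.sum_sub_distrib, Finset.sum_const,
      Finset.card_univ, Fintype.card_fin, nsmul_eq_mul]
    linarith

theorem IsSample.measure_forall_notMem_le [IsProbabilityMeasure ν] (hX : IsSample μ X ν)
    {A : Set (Space D)} (hA : MeasurableSet A) :
    μ.real {ω | ∀ k, X k ω ∉ A} ≤ Real.exp (-n * ν.real A) := by
  have hset : {ω | ∀ k, X k ω ∉ A} = ⋂ k ∈ Finset.univ, X k ⁻¹' Aᶜ := by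
    ext ω
    simp
  have h1 : ∀ k, μ (X k ⁻¹' Aᶜ) = ν Aᶜ := fun k => by
    rw [← hX.law k, Measure.map_apply (hX.measurable k) hA.compl]
  have h2 := hX.indep.measure_inter_preimage_eq_mul Finset.univ (sets := fun _ => Aᶜ)
    fun _ _ => hA.compl
  rw [measureReal_def, hset, h2]
  simp only [h1, Finset.prod_const, Finset.card_univ, Fintype.card_fin, ENNReal.toReal_pow]
  rw [← measureReal_def, probReal_compl_eq_one_sub hA,
    show -(n : ℝ) * ν.real A = n * (-ν.real A) by ring, Real.exp_nat_mul]
  have := measureReal_le_one (μ := ν) (s := A)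
  exact pow_le_pow_left₀ (by linarith) (by linarith [Real.add_one_le_exp (-ν.real A)]) n

end Sample

/-! ### The mixture -/

section Model

variable {D M : ℕ} {P₀ : Measure (Space D)} {P : Fin M → Measure (Space D)} {γ : Fin M → ℝ}
  {δ ε κ₀ : ℝ}

theorem mixture_apply (A : Set (Space D)) : mixture P₀ P γ ε A =
    ENNReal.ofReal ε * P₀ A +
      ENNReal.ofReal (1 - ε) * ∑ i, ENNReal.ofReal (γ i) * P i A := by
  simp [mixture, Measure.add_apply, Measure.finsetSum_apply, Measure.smul_apply]

theorem measurableSet_support (Q : Measure (Space D)) : MeasurableSet Q.support :=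
  Measure.isClosed_support.measurableSet

theorem isClosed_cube : IsClosed (cube D) := by
  have : cube D = ⋂ j, (fun x : Space D => x j) ⁻¹' Set.Icc 0 1 := by
    ext x
    simp [cube]
  rw [this]
  exact isClosed_iInter fun j => isClosed_Icc.preimage (by fun_prop)

theorem support_subset_cube {Q : Measure (Space D)} (h : Q (cube D)ᶜ = 0) :
    Q.support ⊆ cube D := Measure.support_subset_of_isClosed isClosed_cube h

theorem isBounded_cube : Bornology.IsBounded (cube D) := by
  refine (Metric.isBounded_iff_subset_closedBall 0).2 ⟨√D, fun x hx => ?_⟩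
  rw [mem_closedBall_zero_iff, EuclideanSpace.norm_eq]
  refine Real.sqrt_le_sqrt ?_
  calc ∑ j, ‖x j‖ ^ 2 ≤ ∑ _j : Fin D, (1 : ℝ) := by
        refine Finset.sum_le_sum fun j _ => ?_
        have h := hx j
        rw [Real.norm_of_nonneg h.1]
        exact pow_le_one₀ h.1 h.2
    _ = D := by simp

theorem A1.disjoint (h : A1 P δ) {i j : Fin M} (hij : i ≠ j) :
    Disjoint (P i).support (P j).support := Set.disjoint_left.2 fun x hi hj => by
  have := h.2.2 i j hij x hi x hj
  rw [sub_self, norm_zero] at this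
  linarith [h.2.1]

theorem IsModel.apply_support_self (hm : IsModel P₀ P γ) (i : Fin M) : P i (P i).support = 1 := by
  have := hm.prob i
  rw [← prob_compl_eq_zero_iff (measurableSet_support _)]
  exact Measure.measure_compl_support

theorem A1.apply_support_of_ne (h : A1 P δ) {i j : Fin M} (hij : i ≠ j) :
    P j (P i).support = 0 :=
  measure_mono_null (Set.disjoint_left.1 (h.disjoint hij)) Measure.measure_compl_support

/-- Outliers do not fall into the supports of the groups. -/
theorem IsModel.outlier_support (hm : IsModel P₀ P γ) (i : Fin M) : P₀ (P i).support = 0 := by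
  refine measure_mono_null (t := P₀.supportᶜ ∪ (closure (outlierSet P) ∩ (P i).support)) ?_
    (measure_union_null Measure.measure_compl_support (hm.inter₀ i))
  intro x hx
  by_cases h : x ∈ P₀.support
  · exact Or.inr ⟨hm.support₀ h, hx⟩
  · exact Or.inl h

theorem IsModel.isProbabilityMeasure_mixture (hm : IsModel P₀ P γ) (h0 : 0 ≤ ε) (h1 : ε ≤ 1) :
    IsProbabilityMeasure (mixture P₀ P γ ε) := by
  have := hm.prob₀
  have := hm.prob
  constructor
  rw [mixture_apply]
  simp only [measure_univ, mul_one]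
  rw [← ENNReal.ofReal_sum_of_nonneg fun i _ => hm.weight_nonneg i, hm.weight_sum,
    ← ENNReal.ofReal_mul (by linarith), ← ENNReal.ofReal_add h0 (by linarith)]
  simp

theorem IsModel.mixture_of_subset (hm : IsModel P₀ P γ) (hA1 : A1 P δ) (h1 : ε ≤ 1) {i : Fin M}
    {A : Set (Space D)} (hA : A ⊆ (P i).support) :
    (mixture P₀ P γ ε).real A = (1 - ε) * γ i * (P i).real A := by
  have h0 : P₀ A = 0 := measure_mono_null hA (hm.outlier_support i)
  have hj : ∀ j ≠ i, P j A = 0 := fun j hij =>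
    measure_mono_null hA (hA1.apply_support_of_ne hij.symm)
  rw [measureReal_def, mixture_apply, h0, mul_zero, zero_add,
    Finset.sum_eq_single i (fun j _ hij => by rw [hj j hij, mul_zero]) (by simp),
    ENNReal.toReal_mul, ENNReal.toReal_mul, ENNReal.toReal_ofReal (by linarith),
    ENNReal.toReal_ofReal (hm.weight_nonneg i), measureReal_def, mul_assoc]

theorem IsModel.mixture_support (hm : IsModel P₀ P γ) (hA1 : A1 P δ) (h1 : ε ≤ 1) (i : Fin M) :
    (mixture P₀ P γ ε).real (P i).support = (1 - ε) * γ i := by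
  rw [hm.mixture_of_subset hA1 h1 subset_rfl, measureReal_def, hm.apply_support_self]
  simp

theorem mixture_of_disjoint {A : Set (Space D)}
    (hA : A ⊆ (⋃ i, (P i).support)ᶜ) :
    mixture P₀ P γ ε A = ENNReal.ofReal ε * P₀ A := by
  have hj : ∀ j, P j A = 0 := fun j => measure_mono_null
    (fun x hx hxj => hA hx (Set.mem_iUnion.2 ⟨j, hxj⟩)) Measure.measure_compl_support
  simp [mixture_apply, hj]

theorem IsModel.mixture_compl (hm : IsModel P₀ P γ) :
    mixture P₀ P γ ε (⋃ i, (P i).support)ᶜ = ENNReal.ofReal ε := by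
  have := hm.prob₀
  have h : P₀ (⋃ i, (P i).support)ᶜ = 1 := by
    rw [prob_compl_eq_one_iff (MeasurableSet.iUnion fun i => measurableSet_support _)]
    exact measure_iUnion_null hm.outlier_support
  rw [mixture_of_disjoint subset_rfl, h, mul_one]

theorem hausdorff_closedBall (z : Space D) {t : ℝ} (ht : 0 ≤ t) :
    hausdorff D D (Metric.closedBall z t) =
      ENNReal.ofReal (t ^ D * (hausdorff D D (Metric.ball 0 1)).toReal) := by
  have hfin : Module.finrank ℝ (Space D) = D := finrank_euclideanSpace_fin
  have hinst : (Measure.hausdorffMeasure (D : ℝ) : Measure (Space D)).IsAddHaarMeasure := by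
    have := isAddHaarMeasure_hausdorffMeasure (E := Space D)
    rwa [hfin] at this
  have hne : hausdorff D D (Metric.ball 0 1) ≠ ⊤ := by
    rw [hausdorff, Measure.smul_apply, smul_eq_mul]
    exact ENNReal.mul_ne_top ENNReal.ofReal_ne_top measure_ball_lt_top.ne
  rw [ENNReal.ofReal_mul (by positivity), ENNReal.ofReal_toReal hne, hausdorff,
    Measure.smul_apply, Measure.smul_apply, Measure.addHaar_closedBall _ _ ht, hfin]
  simp only [smul_eq_mul]
  ring

/-- Balls contain few outliers. -/
theorem IsModel.mixture_outlier_ball_le (hm : IsModel P₀ P γ) (hA2 : A2 P₀ P κ₀) (h0 : 0 ≤ ε)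
    {t : ℝ} (ht : 0 ≤ t) (z : Space D) :
    mixture P₀ P γ ε ((⋃ i, (P i).support)ᶜ ∩ Metric.closedBall z t) ≤
      ENNReal.ofReal (κ₀ * (hausdorff D D (Metric.ball 0 1)).toReal * ε * t ^ D) := by
  rw [mixture_of_disjoint Set.inter_subset_left]
  have hκ := hA2.1
  have hmeas : MeasurableSet (outlierSet P ∩ Metric.closedBall z t) :=
    (isClosed_cube.measurableSet.diff
      (MeasurableSet.iUnion fun i => measurableSet_support _)).inter
      Metric.isClosed_closedBall.measurableSet
  have h1 : P₀ ((⋃ i, (P i).support)ᶜ ∩ Metric.closedBall z t) ≤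
      P₀ (outlierSet P ∩ Metric.closedBall z t) := by
    refine (measure_mono (t := (OSL.cube D)ᶜ ∪ (outlierSet P ∩ Metric.closedBall z t)) ?_).trans
      ((measure_union_le _ _).trans ?_)
    · rintro x ⟨hx, hxz⟩
      by_cases hc : x ∈ OSL.cube D
      · exact Or.inr ⟨⟨hc, hx⟩, hxz⟩
      · exact Or.inl hc
    · rw [hm.cube₀, zero_add]
  have h2 := (h1.trans (hA2.2 _ Set.inter_subset_left hmeas)).trans
    (mul_le_mul_right (measure_mono Set.inter_subset_right) _)
  rw [hausdorff_closedBall z ht, ← ENNReal.ofReal_mul hκ.le] at h2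
  refine (mul_le_mul_right h2 _).trans (le_of_eq ?_)
  rw [← ENNReal.ofReal_mul h0]
  congr 1
  ring

end Model

/-! ### Connecting the observations of a group -/

/-- A lower bound on `ballVol` that makes the constants depend on the maximal dimension only. -/
theorem exists_pos_le_ballVol (d : ℝ) : ∃ η > 0, ∀ s ∈ Set.Icc 0 d, η ≤ ballVol s := by
  by_cases hd : 0 ≤ d
  · have hcont : ContinuousOn ballVol (Set.Icc 0 d) := by
      intro s hs
      have hG : ContinuousAt Real.Gamma (1 + s / 2) :=
        (Real.differentiableAt_Gamma fun m h => by
          have := hs.1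
          have : (0 : ℝ) ≤ m := m.cast_nonneg
          linarith).continuousAt
      have hG0 : 0 < Real.Gamma (1 + s / 2) := Real.Gamma_pos_of_pos (by linarith [hs.1])
      refine ContinuousAt.continuousWithinAt (ContinuousAt.div ?_ ?_ hG0.ne')
      · exact ContinuousAt.rpow continuousAt_const (by fun_prop) (Or.inl Real.pi_ne_zero)
      · exact ContinuousAt.comp (f := fun s : ℝ => 1 + s / 2) hG (by fun_prop)
    obtain ⟨s, hs, hmin⟩ := isCompact_Icc.exists_isMinOn ⟨0, Set.left_mem_Icc.2 hd⟩ hcont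
    refine ⟨ballVol s, ?_, fun u hu => hmin hu⟩
    exact div_pos (Real.rpow_pos_of_pos Real.pi_pos _)
      (Real.Gamma_pos_of_pos (by linarith [hs.1]))
  · exact ⟨1, one_pos, fun s hs => absurd (hs.1.trans hs.2) hd⟩

/-- A maximal packing of a connected set by balls of mass at least `c` has at most `1 / c` balls,
and observations in all of them are enough for single linkage to connect the set. -/
theorem exists_packing {D : ℕ} (Q : Measure (Space D)) [IsProbabilityMeasure Q]
    {S : Set (Space D)} (hS : IsPreconnected S) (hmeas : MeasurableSet S) {c ρ : ℝ} (hc : 0 < c)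
    (hρ : 0 < ρ) (hQ : ∀ y ∈ S, c ≤ Q.real (S ∩ Metric.closedBall y ρ)) :
    ∃ (N : ℕ) (y : Fin N → Space D), (N : ℝ) ≤ c⁻¹ ∧ (∀ j, y j ∈ S) ∧
      ∀ (n : ℕ) (x : Fin n → Space D), (∀ j, ∃ k, x k ∈ S ∩ Metric.closedBall (y j) ρ) →
        ∀ k l, x k ∈ S → x l ∈ S → (linkGraph x (6 * ρ)).Reachable k l := by
  classical
  let p : ℕ → Prop := fun m => ∃ T : Finset (Space D), T.card = m ∧ (T : Set (Space D)) ⊆ S ∧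
    (T : Set (Space D)).Pairwise fun a b => 2 * ρ < dist a b
  have hp : ∀ m, p m → (m : ℝ) ≤ c⁻¹ := by
    rintro m ⟨T, rfl, hTS, hsep⟩
    have hdisj : (T : Set (Space D)).PairwiseDisjoint
        fun y => S ∩ Metric.closedBall y ρ := by
      intro a ha b hb hab
      refine Set.disjoint_left.2 fun z hza hzb => ?_
      have h1 := Metric.mem_closedBall.1 hza.2
      have h2 := Metric.mem_closedBall.1 hzb.2
      linarith [hsep ha hb hab, dist_triangle_left a b z]
    have hsum := measureReal_biUnion_finset (μ := Q) hdisj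
      fun y _ => hmeas.inter Metric.isClosed_closedBall.measurableSet
    have h1 : T.card • c ≤ ∑ y ∈ T, Q.real (S ∩ Metric.closedBall y ρ) :=
      Finset.card_nsmul_le_sum T _ c fun y hy => hQ y (hTS hy)
    rw [← hsum, nsmul_eq_mul] at h1
    rw [← one_div, le_div_iff₀ hc]
    exact h1.trans measureReal_le_one
  have hbd : ∀ m, p m → m ≤ ⌊c⁻¹⌋₊ := fun m hm => Nat.le_floor (hp m hm)
  have hp0 : p 0 := ⟨∅, by simp⟩
  have hpN : p (Nat.findGreatest p ⌊c⁻¹⌋₊) := Nat.findGreatest_spec (Nat.zero_le _) hp0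
  obtain ⟨T, hcard, hTS, hsep⟩ := id hpN
  have hcov : ∀ z ∈ S, ∃ y ∈ T, dist z y ≤ 2 * ρ := by
    intro z hz
    by_contra hno
    push Not at hno
    have hzT : z ∉ T := fun h => by
      have := hno z h
      rw [dist_self] at this
      linarith
    have hpz : p (T.card + 1) := by
      refine ⟨insert z T, Finset.card_insert_of_notMem hzT, ?_, ?_⟩
      · rw [Finset.coe_insert]
        exact Set.insert_subset hz hTS
      · rw [Finset.coe_insert]
        refine hsep.insert fun b hb _ => ⟨hno b hb, ?_⟩
        rw [dist_comm]
        exact hno b hb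
    have := Nat.le_findGreatest (hbd _ hpz) hpz
    omega
  let y : Fin T.card → Space D := fun j => (T.equivFin.symm j : Space D)
  have hyS : ∀ j, y j ∈ S := fun j => hTS (T.equivFin.symm j).2
  have hcov' : ∀ z ∈ S, ∃ j, dist z (y j) ≤ 2 * ρ := fun z hz => by
    obtain ⟨w, hw, hd⟩ := hcov z hz
    exact ⟨T.equivFin ⟨w, hw⟩, by simpa [y] using hd⟩
  refine ⟨T.card, y, hp _ (hcard ▸ hpN), hyS, fun n x hx => ?_⟩
  choose o ho using hx
  have hSsub : S ⊆ ⋃ j, Metric.closedBall (y j) (4 * ρ / 2) := fun z hz => by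
    obtain ⟨j, hj⟩ := hcov' z hz
    exact Set.mem_iUnion.2 ⟨j, Metric.mem_closedBall.2 (by linarith)⟩
  have hreach : ∀ i j, (linkGraph x (6 * ρ)).Reachable (o i) (o j) := by
    intro i j
    have hij : (linkGraph y (4 * ρ)).Reachable i j :=
      (mem_connectedComponentIn_iff_reachable y (by positivity) i j).1
        (hS.subset_connectedComponentIn (hyS i) hSsub (hyS j))
    obtain ⟨w⟩ := hij
    induction w with
    | nil => exact SimpleGraph.Reachable.refl _
    | @cons a b e h w ih =>
      refine (reachable_of_norm_le ?_).trans ih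
      have h1 := h.2
      have h2 := Metric.mem_closedBall.1 (ho a).2
      have h3 := Metric.mem_closedBall.1 (ho b).2
      rw [← dist_eq_norm] at h1 ⊢
      linarith [dist_triangle4_right (x (o a)) (x (o b)) (y a) (y b)]
  have hnear : ∀ k, x k ∈ S → ∃ j, (linkGraph x (6 * ρ)).Reachable k (o j) := fun k hk => by
    obtain ⟨j, hj⟩ := hcov' _ hk
    refine ⟨j, reachable_of_norm_le ?_⟩
    have h2 := Metric.mem_closedBall.1 (ho j).2
    rw [← dist_eq_norm]
    linarith [dist_triangle_right (x k) (x (o j)) (y j)]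
  intro k l hk hl
  obtain ⟨i, hi⟩ := hnear k hk
  obtain ⟨j, hj⟩ := hnear l hl
  exact hi.trans ((hreach i j).trans hj.symm)

theorem dim_nonneg {D : ℕ} (S : Set (Space D)) : 0 ≤ dim S := ENNReal.toReal_nonneg

theorem dim_le_maxDim {D M : ℕ} (P : Fin M → Measure (Space D)) (i : Fin M) :
    dim (P i).support ≤ maxDim P :=
  le_ciSup (f := fun i => dim (P i).support) (Set.finite_range _).bddAbove i

/-- Balls centred in a group have a mass of at least the order `ρ ^ d`. -/
theorem le_measure_ball {D M : ℕ} {P : Fin M → Measure (Space D)} {κ : Fin M → ℝ}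
    {κc η : ℝ} (hprob : ∀ i, IsProbabilityMeasure (P i)) (hA3 : A3 P κ) (hA4 : A4 P κc)
    (hη : 0 < η) (hηb : ∀ s ∈ Set.Icc 0 (maxDim P), η ≤ ballVol s) (i : Fin M)
    {y : Space D} (hy : y ∈ (P i).support) {ρ : ℝ} (h0 : 0 < ρ) (h1 : ρ ≤ 1)
    (hdiam : ρ ≤ Metric.diam (P i).support) :
    (κ i)⁻¹ * (κc⁻¹ * η) * ρ ^ maxDim P ≤
      (P i).real ((P i).support ∩ Metric.closedBall y ρ) := by
  have := hprob i
  obtain ⟨hκ, h3⟩ := hA3 i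
  have hκc : 0 < κc := one_pos.trans_le hA4.1
  have h4 := (hA4.2 i y hy ρ h0 hdiam).1
  have h5 := h3 _ Set.inter_subset_left
    ((measurableSet_support (P i)).inter
      (Metric.isClosed_closedBall (x := y) (ε := ρ)).measurableSet)
  have h6 := (mul_le_mul_right h4 (ENNReal.ofReal (κ i)⁻¹)).trans h5
  rw [← ENNReal.ofReal_mul (inv_nonneg.2 hκ.le), ENNReal.ofReal_le_iff_le_toReal
    (measure_ne_top _ _)] at h6
  refine le_trans ?_ h6
  have h7 := hηb _ ⟨dim_nonneg _, dim_le_maxDim P i⟩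
  have h8 : ρ ^ maxDim P ≤ ρ ^ dim (P i).support :=
    Real.rpow_le_rpow_of_exponent_ge h0 h1 (dim_le_maxDim P i)
  have h9 : 0 ≤ ballVol (dim (P i).support) := hη.le.trans h7
  rw [mul_assoc, mul_assoc]
  gcongr

/-- With high probability the observations of a group are in one single linkage cluster. -/
theorem measure_not_connected_le {D M n : ℕ} {P₀ : Measure (Space D)}
    {P : Fin M → Measure (Space D)} {γ κ : Fin M → ℝ} {κc η δ ε : ℝ}
    (hm : IsModel P₀ P γ) (hA1 : A1 P δ) (hA3 : A3 P κ) (hA4 : A4 P κc)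
    (hη : 0 < η) (hηb : ∀ s ∈ Set.Icc 0 (maxDim P), η ≤ ballVol s) (h0 : 0 ≤ ε) (h1 : ε ≤ 1)
    {Ω : Type*} [MeasurableSpace Ω] {μ : Measure Ω} [IsProbabilityMeasure μ]
    {X : Fin n → Ω → Space D} (hX : IsSample μ X (mixture P₀ P γ ε)) (i : Fin M)
    {t c : ℝ} (ht0 : 0 < t) (ht1 : t ≤ 1) (hc : 0 < c)
    (hcκ : c ≤ (κ i)⁻¹ * (κc⁻¹ * η) * (t / 6) ^ maxDim P) :
    μ.real {ω | ∃ k l, X k ω ∈ (P i).support ∧ X l ω ∈ (P i).support ∧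
      ¬ (linkGraph (fun k => X k ω) t).Reachable k l} ≤
      c⁻¹ * Real.exp (-n * ((1 - ε) * γ i * c)) := by
  have := hm.prob i
  have := hm.isProbabilityMeasure_mixture h0 h1
  by_cases hd : t / 6 ≤ Metric.diam (P i).support
  · have hball : ∀ y ∈ (P i).support,
        c ≤ (P i).real ((P i).support ∩ Metric.closedBall y (t / 6)) := fun y hy =>
      hcκ.trans (le_measure_ball hm.prob hA3 hA4 hη hηb i hy (by positivity) (by linarith) hd)
    obtain ⟨N, y, hN, hyS, hconn⟩ := exists_packing (P i) (hA1.1 i).isPreconnected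
      (measurableSet_support _) hc (by positivity : 0 < t / 6) hball
    rw [show 6 * (t / 6) = t by ring] at hconn
    have hsub : {ω | ∃ k l, X k ω ∈ (P i).support ∧ X l ω ∈ (P i).support ∧
        ¬ (linkGraph (fun k => X k ω) t).Reachable k l} ⊆
        ⋃ j, {ω | ∀ k, X k ω ∉ (P i).support ∩ Metric.closedBall (y j) (t / 6)} := by
      rintro ω ⟨k, l, hk, hl, hkl⟩
      by_contra hno
      simp only [Set.mem_iUnion, Set.mem_ofPred_eq, not_exists, not_forall, not_not] at hno
      exact hkl (hconn n (fun k => X k ω) hno k l hk hl)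
    refine (measureReal_mono hsub).trans ((measureReal_iUnion_fintype_le _).trans ?_)
    calc ∑ j, μ.real {ω | ∀ k, X k ω ∉ (P i).support ∩ Metric.closedBall (y j) (t / 6)}
        ≤ ∑ _j : Fin N, Real.exp (-n * ((1 - ε) * γ i * c)) := by
          refine Finset.sum_le_sum fun j _ => (hX.measure_forall_notMem_le
            ((measurableSet_support _).inter Metric.isClosed_closedBall.measurableSet)).trans ?_
          rw [hm.mixture_of_subset hA1 h1 Set.inter_subset_left, Real.exp_le_exp, neg_mul,
            neg_mul, neg_le_neg_iff]
          have := mul_nonneg (sub_nonneg.2 h1) (hm.weight_nonneg i)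
          gcongr
          exact hball _ (hyS j)
      _ = N * Real.exp (-n * ((1 - ε) * γ i * c)) := by simp
      _ ≤ c⁻¹ * Real.exp (-n * ((1 - ε) * γ i * c)) := by gcongr
  · -- a group of small diameter is connected at once
    have hempty : {ω | ∃ k l, X k ω ∈ (P i).support ∧ X l ω ∈ (P i).support ∧
        ¬ (linkGraph (fun k => X k ω) t).Reachable k l} = ∅ := by
      refine Set.eq_empty_of_forall_notMem ?_
      rintro ω ⟨k, l, hk, hl, hkl⟩
      refine hkl (reachable_of_norm_le ?_)
      rw [← dist_eq_norm]
      have := Metric.dist_le_diam_of_mem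
        (isBounded_cube.subset (support_subset_cube (hm.cube i))) hk hl
      linarith
    rw [hempty, measureReal_empty]
    positivity

/-! ### Bounds on the risk -/

/-- The slack in the assumption on the weights, which does not depend on `ε`. -/
theorem A6.slack {M : ℕ} {γ : Fin M → ℝ} {ε : ℝ} (hγ0 : ∀ i, 0 ≤ γ i) (hγ1 : ∑ i, γ i = 1)
    (h : A6 γ ε) : 0 < gammaBar γ ∧ 0 ≤ ε ∧ ε ≤ 1 / 2 ∧
      (∀ i, (⨅ i, γ i) ≤ γ i) ∧ (∀ i, ε + gammaBar γ / 4 ≤ (1 - ε) * γ i) ∧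
      ∀ i j, (1 - ε) * γ i + ε + gammaBar γ / 2 ≤ 2 * ((1 - ε) * γ j) := by
  obtain ⟨h1, h2, h3⟩ := h
  have hle : ∀ i, (⨅ i, γ i) ≤ γ i := fun i => ciInf_le (Set.finite_range _).bddBelow i
  have hge : ∀ i, γ i ≤ ⨆ i, γ i := fun i => le_ciSup (Set.finite_range _).bddAbove i
  have hone : ∀ i, γ i ≤ 1 := fun i => by
    rw [← hγ1]
    exact Finset.single_le_sum (fun j _ => hγ0 j) (Finset.mem_univ i)
  have hM : Nonempty (Fin M) := by
    by_contra hne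
    rw [not_nonempty_iff] at hne
    simp at hγ1
  obtain ⟨i₀⟩ := hM
  have hb : gammaBar γ = (⨅ i, γ i) - (⨆ i, γ i) / 2 := rfl
  have hpos : 0 < gammaBar γ := by linarith
  have e1 := hle i₀
  have e2 := hge i₀
  have e3 := hone i₀
  have e4 := hγ0 i₀
  rw [lt_div_iff₀ (by linarith)] at h3
  have hε : ε < (1 - ε) * gammaBar γ := by linarith
  have hhalf : ε ≤ 1 / 2 := by nlinarith
  refine ⟨hpos, h2, hhalf, hle, fun i => ?_, fun i j => ?_⟩
  · have := mul_le_mul_of_nonneg_left (hle i) (show 0 ≤ 1 - ε by linarith)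
    nlinarith
  · have := mul_le_mul_of_nonneg_left (hle j) (show 0 ≤ 1 - ε by linarith)
    have := mul_le_mul_of_nonneg_left (hge i) (show 0 ≤ 1 - ε by linarith)
    nlinarith

/-- The risk is at most the probability that the numbers of observations deviate, plus the
probability that some group is not connected at radius `t`, plus the probability that outliers link
two groups at this radius. -/
theorem risk_le {D M n : ℕ} {P₀ : Measure (Space D)}
    {P : Fin M → Measure (Space D)} {γ κ : Fin M → ℝ} {κ₀ κc η δ ε : ℝ}
    (hm : IsModel P₀ P γ) (hA1 : A1 P δ) (hA2 : A2 P₀ P κ₀) (hA3 : A3 P κ) (hA4 : A4 P κc)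
    (hη : 0 < η) (hηb : ∀ s ∈ Set.Icc 0 (maxDim P), η ≤ ballVol s) (hA6 : A6 γ ε) (hMn : M ≤ n)
    {Ω : Type*} [MeasurableSpace Ω] {μ : Measure Ω} [IsProbabilityMeasure μ]
    {X : Fin n → Ω → Space D} (hX : IsSample μ X (mixture P₀ P γ ε))
    {t c : ℝ} {m : ℕ} (ht0 : 0 < t) (ht1 : t ≤ 1) (hmt : (m + 1) * t < δ) (hc : 0 < c)
    (hcκ : ∀ i, c ≤ (κ i)⁻¹ * (κc⁻¹ * η) * (t / 6) ^ maxDim P) :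
    risk μ P X ≤ 2 * (M + 1) * Real.exp (-2 * (gammaBar γ / 8) ^ 2 * n) +
      M * c⁻¹ * Real.exp (-n * ((⨅ i, γ i) / 2 * c)) +
      n * ε * (n * (κ₀ * (hausdorff D D (Metric.ball 0 1)).toReal * ε * t ^ D)) ^ m := by
  obtain ⟨hb, h0, h1, hinf, hs1, hs2⟩ := hA6.slack hm.weight_nonneg hm.weight_sum
  have := hm.isProbabilityMeasure_mixture h0 (by linarith : ε ≤ 1)
  have hM : 0 < M := by
    rcases Nat.eq_zero_or_pos M with rfl | h
    · have := hm.weight_sum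
      simp at this
    · exact h
  have hn : (0 : ℝ) < n := by exact_mod_cast hM.trans_le hMn
  set ν := mixture P₀ P γ ε with hν
  set α := gammaBar γ / 8 with hα
  let O : Set (Space D) := (⋃ i, (P i).support)ᶜ
  have hO : MeasurableSet O := (MeasurableSet.iUnion fun i => measurableSet_support _).compl
  let dev : Set (Space D) → Set Ω := fun A =>
    {ω | α * n ≤ |((indices (fun k => X k ω) A).card : ℝ) - n * ν.real A|}
  let disc : Fin M → Set Ω := fun i => {ω | ∃ k l, X k ω ∈ (P i).support ∧
    X l ω ∈ (P i).support ∧ ¬ (linkGraph (fun k => X k ω) t).Reachable k l}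
  let chain : Set Ω := {ω | ∃ f : Fin (m + 1) → Fin n, Function.Injective f ∧
      (fun s => X (f s) ω) ∈ chainSet O t m}
  have hsub : {ω | ∀ π : Equiv.Perm (Fin M), ∃ i,
      ¬ ∀ k, X k ω ∈ (P i).support → k ∈ oslCluster M (fun k => X k ω) (π i)} ⊆
      ((dev O ∪ ⋃ i, dev (P i).support) ∪ ⋃ i, disc i) ∪ chain := by
    intro ω hω
    by_contra hno
    simp only [Set.mem_union, Set.mem_iUnion, not_or, not_exists] at hno
    obtain ⟨⟨⟨hdO, hdS⟩, hdisc⟩, hchain⟩ := hno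
    have hcO : ((indices (fun k => X k ω) O).card : ℝ) < n * ε + α * n := by
      have hdO' : ¬ α * n ≤ |((indices (fun k => X k ω) O).card : ℝ) - n * ν.real O| := hdO
      have := (abs_lt.1 (not_le.1 hdO')).2
      have hε : ν.real O = ε := by
        rw [measureReal_def, hm.mixture_compl, ENNReal.toReal_ofReal h0]
      rw [hε] at this
      linarith
    have hcS : ∀ i, n * ((1 - ε) * γ i) - α * n <
          ((indices (fun k => X k ω) (P i).support).card : ℝ) ∧
        ((indices (fun k => X k ω) (P i).support).card : ℝ) <
          n * ((1 - ε) * γ i) + α * n := fun i => by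
      have hdS' : ¬ α * n ≤ |((indices (fun k => X k ω) (P i).support).card : ℝ) -
          n * ν.real (P i).support| := hdS i
      have := abs_lt.1 (not_le.1 hdS')
      rw [hm.mixture_support hA1 (by linarith)] at this
      constructor <;> linarith
    have hperm : ∃ π : Equiv.Perm (Fin M), ∀ i, ∀ k ∈ indices (fun k => X k ω) (P i).support,
        k ∈ oslCluster M (fun k => X k ω) (π i) := by
      refine exists_perm_oslCluster hM (fun k => X k ω)
        (fun i => indices (fun k => X k ω) (P i).support) (indices (fun k => X k ω) O) ht0.le
        (fun k => ?_) (fun i => ?_) (fun i j => ?_) (fun i k hk l hl => ?_)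
        (fun i j hij k hk l hl hkl => ?_)
      · by_cases hk : X k ω ∈ O
        · exact Or.inl (mem_indices.2 hk)
        · obtain ⟨i, hi⟩ := Set.mem_iUnion.1 (not_not.1 hk)
          exact Or.inr ⟨i, mem_indices.2 hi⟩
      · have e1 := mul_le_mul_of_nonneg_left (hs1 i) hn.le
        have e2 := (hcS i).1
        have : ((indices (fun k => X k ω) O).card : ℝ) <
            (indices (fun k => X k ω) (P i).support).card := by
          rw [show gammaBar γ / 4 = 2 * α by rw [hα]; ring] at e1
          linarith
        exact_mod_cast this
      · have e1 := mul_le_mul_of_nonneg_left (hs2 i j) hn.le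
        have e2 := (hcS i).2
        have e3 := (hcS j).1
        have : ((indices (fun k => X k ω) (P i).support).card : ℝ) +
            (indices (fun k => X k ω) O).card <
            2 * (indices (fun k => X k ω) (P j).support).card := by
          rw [show gammaBar γ / 2 = 4 * α by rw [hα]; ring] at e1
          linarith
        exact_mod_cast this
      · by_contra hkl
        exact hdisc i ⟨k, l, mem_indices.1 hk, mem_indices.1 hl, hkl⟩
      · exact hchain (exists_chain_of_reachable (fun i => (P i).support) hmt ht0.le hA1.2.2
          ⟨i, j, hij, k, l, mem_indices.1 hk, mem_indices.1 hl, hkl⟩)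
    obtain ⟨π, hπ⟩ := hperm
    obtain ⟨i, hi⟩ := hω π
    exact hi fun k hk => hπ i k (mem_indices.2 hk)
  have hdev : ∀ A, MeasurableSet A → μ.real (dev A) ≤ 2 * Real.exp (-2 * α ^ 2 * n) :=
    fun A hA => hX.measure_card_deviation_le hA (by positivity)
  have hdisc : ∀ i, μ.real (disc i) ≤ c⁻¹ * Real.exp (-n * ((⨅ i, γ i) / 2 * c)) := by
    intro i
    refine (measure_not_connected_le hm hA1 hA3 hA4 hη hηb h0 (by linarith) hX i ht0 ht1 hc
      (hcκ i)).trans ?_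
    have e1 : (⨅ i, γ i) / 2 ≤ (1 - ε) * γ i := by nlinarith [hinf i, hm.weight_nonneg i]
    have e2 := mul_le_mul_of_nonneg_left (mul_le_mul_of_nonneg_right e1 hc.le) hn.le
    gcongr _ * Real.exp ?_
    linarith
  have hK : 0 ≤ κ₀ * (hausdorff D D (Metric.ball (0 : Space D) 1)).toReal * ε * t ^ D := by
    have := hA2.1
    positivity
  have hchain : μ.real chain ≤
      n * ε * (n * (κ₀ * (hausdorff D D (Metric.ball 0 1)).toReal * ε * t ^ D)) ^ m := by
    have h := hX.measure_exists_chain_le hO t _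
      (fun z => hm.mixture_outlier_ball_le hA2 h0 ht0.le z) m
    have h' := ENNReal.toReal_mono (by
      refine ENNReal.mul_ne_top (by simp) (ENNReal.mul_ne_top (measure_ne_top _ _) ?_)
      exact ENNReal.pow_ne_top ENNReal.ofReal_ne_top) h
    rw [hm.mixture_compl, ENNReal.toReal_mul, ENNReal.toReal_mul, ENNReal.toReal_pow,
      ENNReal.toReal_pow, ENNReal.toReal_ofReal h0, ENNReal.toReal_ofReal hK,
      ENNReal.toReal_natCast] at h'
    refine h'.trans (le_of_eq ?_)
    rw [mul_pow]
    ring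
  calc risk μ P X ≤ μ.real (((dev O ∪ ⋃ i, dev (P i).support) ∪ ⋃ i, disc i) ∪ chain) :=
        measureReal_mono hsub
    _ ≤ ((μ.real (dev O) + ∑ i, μ.real (dev (P i).support)) + ∑ i, μ.real (disc i)) +
          μ.real chain := by
        refine (measureReal_union_le _ _).trans (add_le_add_left ?_ _)
        refine (measureReal_union_le _ _).trans (add_le_add ?_ (measureReal_iUnion_fintype_le _))
        refine (measureReal_union_le _ _).trans (add_le_add_right ?_ _)
        exact measureReal_iUnion_fintype_le _
    _ ≤ ((2 * Real.exp (-2 * α ^ 2 * n) + ∑ _i : Fin M, 2 * Real.exp (-2 * α ^ 2 * n)) +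
          ∑ _i : Fin M, c⁻¹ * Real.exp (-n * ((⨅ i, γ i) / 2 * c))) +
          n * ε * (n * (κ₀ * (hausdorff D D (Metric.ball 0 1)).toReal * ε * t ^ D)) ^ m := by
        refine add_le_add (add_le_add (add_le_add (hdev O hO) (Finset.sum_le_sum fun i _ =>
          hdev _ (measurableSet_support _))) (Finset.sum_le_sum fun i _ => hdisc i)) hchain
    _ = _ := by
        simp only [Finset.sum_const, Finset.card_univ, Fintype.card_fin, nsmul_eq_mul]
        ring

/-- In dimension `0` a group would fill the whole space and leave no room for `P₀`. -/
theorem IsModel.dim_pos {D M : ℕ} {P₀ : Measure (Space D)} {P : Fin M → Measure (Space D)}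
    {γ : Fin M → ℝ} (hm : IsModel P₀ P γ) (hM : 0 < M) : 0 < D := by
  rcases Nat.eq_zero_or_pos D with rfl | h
  · have := hm.prob₀
    have h0 := hm.outlier_support ⟨0, hM⟩
    have h1 := hm.apply_support_self ⟨0, hM⟩
    rcases Set.eq_empty_or_nonempty (P ⟨0, hM⟩).support with h | h
    · rw [h, measure_empty] at h1
      exact absurd h1 zero_ne_one
    · rw [Subsingleton.eq_univ_of_nonempty h, measure_univ] at h0
      exact absurd h0 one_ne_zero
  · exact h

/-- The risk at the scale `t = τ / u`, for a constant `τ`. The condition `n ≤ u ^ (d + 1)` makes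
chains of outliers at least as unlikely as groups that are not connected. -/
theorem exists_risk_le_of_scale {D M : ℕ} {d δ κ₀ κc : ℝ} {γ κ : Fin M → ℝ} (hD : 0 < D)
    (hM : 0 < M) (hδ : 0 < δ) (hκ₀ : 0 < κ₀) (hκc : 1 ≤ κc) (hκ : ∀ i, 0 < κ i) (hd : 0 ≤ d)
    (hb : 0 < gammaBar γ) (hγ : 0 < ⨅ i, γ i) :
    ∃ C > 0, ∃ c > 0, ∀ (P₀ : Measure (Space D)) (P : Fin M → Measure (Space D)),
      IsModel P₀ P γ → maxDim P = d → A1 P δ → A2 P₀ P κ₀ → A3 P κ → A4 P κc →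
      ∀ (n : ℕ) (ε : ℝ), M ≤ n → A6 γ ε →
      ∀ (Ω : Type*) [MeasurableSpace Ω] (μ : Measure Ω) [IsProbabilityMeasure μ]
        (X : Fin n → Ω → Space D), IsSample μ X (mixture P₀ P γ ε) →
        (ε = Real.exp (-n) → risk μ P X ≤ C * n * Real.exp (-c * n)) ∧
        ∀ u : ℝ, 1 ≤ u → n ≤ u ^ (d + 1) → n * ε ≤ u ^ D →
          risk μ P X ≤ C * u ^ d * Real.exp (-c * (n / u ^ d)) := by
  obtain ⟨η, hη, hηb⟩ := exists_pos_le_ballVol d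
  set K := κ₀ * (hausdorff D D (Metric.ball (0 : Space D) 1)).toReal with hK
  have hK0 : 0 ≤ K := by positivity
  have hκc0 : 0 < κc := by linarith
  set τ := min 1 (min (δ / 2) (Real.exp (-1) / (K + 1))) with hτ
  have hτ0 : 0 < τ := by positivity
  have hτ1 : τ ≤ 1 := min_le_left _ _
  have hτδ : τ ≤ δ / 2 := (min_le_right _ _).trans (min_le_left _ _)
  have hτK : K * τ ≤ Real.exp (-1) := by
    have h : τ ≤ Real.exp (-1) / (K + 1) := (min_le_right _ _).trans (min_le_right _ _)
    rw [le_div_iff₀ (by positivity)] at h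
    nlinarith
  have hκsum : ∀ i, κ i ≤ ∑ j, κ j := fun i =>
    Finset.single_le_sum (fun j _ => (hκ j).le) (Finset.mem_univ i)
  have hκpos : 0 < ∑ j, κ j := (hκ ⟨0, hM⟩).trans_le (hκsum _)
  set B := (∑ j, κ j)⁻¹ * (κc⁻¹ * η) * (τ / 6) ^ d with hB
  have hB0 : 0 < B := by positivity
  set a := 2 * (gammaBar γ / 8) ^ 2 with ha
  have ha0 : 0 < a := by positivity
  set b := (⨅ i, γ i) / 2 * B with hbdef
  have hb0 : 0 < b := by positivity
  set c := min a (min b 1) with hc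
  have hc0 : 0 < c := by positivity
  have hca : c ≤ a := min_le_left _ _
  have hcb : c ≤ b := (min_le_right _ _).trans (min_le_left _ _)
  have hc1 : c ≤ 1 := (min_le_right _ _).trans (min_le_right _ _)
  set C := 2 * (M + 1) + M * B⁻¹ + Real.exp 2 * D.factorial with hC
  refine ⟨C, by positivity, c, hc0, ?_⟩
  intro P₀ P hm hdim hA1 hA2 hA3 hA4 n ε hMn hA6 Ω _ μ _ X hX
  subst hdim
  obtain ⟨-, h0, h1, -⟩ := hA6.slack hm.weight_nonneg hm.weight_sum
  have hn1 : (1 : ℝ) ≤ n := by exact_mod_cast (Nat.one_le_iff_ne_zero.2 hM.ne').trans hMn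
  -- the first two terms of the bound
  have hterms : ∀ (u : ℝ) (m : ℕ), 1 ≤ u → (m + 1) * (τ / u) < δ →
      risk μ P X ≤ 2 * (M + 1) * (u ^ maxDim P * Real.exp (-c * (n / u ^ maxDim P))) +
        M * B⁻¹ * (u ^ maxDim P * Real.exp (-c * (n / u ^ maxDim P))) +
        n * ε * (n * (K * ε * (τ / u) ^ D)) ^ m := by
    intro u m hu hmu
    have hu0 : 0 < u := by linarith
    have hv1 : 1 ≤ u ^ maxDim P := Real.one_le_rpow hu hd
    set v := u ^ maxDim P with hv
    have hv0 : 0 < v := by linarith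
    have hnv : n / v ≤ n := div_le_self (by positivity) hv1
    have hnv0 : 0 ≤ n / v := by positivity
    have hcB : B / v = (∑ j, κ j)⁻¹ * (κc⁻¹ * η) * (τ / u / 6) ^ maxDim P := by
      rw [hB, hv, div_right_comm τ u 6, Real.div_rpow (by positivity) hu0.le]
      ring
    refine (risk_le hm hA1 hA2 hA3 hA4 hη hηb hA6 hMn hX (t := τ / u) (c := B / v) (m := m)
      (by positivity) ((div_le_self hτ0.le hu).trans hτ1) hmu (by positivity)
      fun i => ?_).trans (add_le_add_left (add_le_add ?_ ?_) _)
    · rw [hcB]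
      have := hκ i
      gcongr
      exact hκsum i
    · refine mul_le_mul_of_nonneg_left ?_ (by positivity)
      refine le_trans ?_ (le_mul_of_one_le_left (Real.exp_nonneg _) hv1)
      rw [Real.exp_le_exp]
      have := mul_le_mul hca hnv hnv0 ha0.le
      rw [ha] at this
      linarith
    · rw [inv_div, show (M : ℝ) * (v / B) = M * B⁻¹ * v by ring, mul_assoc (_ * _) v]
      gcongr _ * (_ * Real.exp ?_)
      have := mul_le_mul_of_nonneg_right hcb hnv0
      have e : (n : ℝ) * ((⨅ i, γ i) / 2 * (B / v)) = b * (n / v) := by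
        rw [hbdef]
        ring
      linarith
  constructor
  · intro hε
    have h := hterms 1 0 le_rfl (by simp; linarith)
    simp only [Real.one_rpow, div_one, one_mul, pow_zero, mul_one] at h
    have e1 : Real.exp (-c * n) ≤ n * Real.exp (-c * n) :=
      le_mul_of_one_le_left (Real.exp_nonneg _) hn1
    have e2 : n * ε ≤ n * Real.exp (-c * n) := by
      rw [hε]
      gcongr
      nlinarith
    have e3 : (1 : ℝ) ≤ Real.exp 2 * D.factorial := by
      have : (1 : ℝ) ≤ D.factorial := by exact_mod_cast Nat.one_le_iff_ne_zero.2 D.factorial_ne_zero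
      exact one_le_mul_of_one_le_of_one_le (Real.one_le_exp (by norm_num)) this
    have e4 : 0 ≤ n * Real.exp (-c * n) := by positivity
    calc risk μ P X ≤ 2 * (M + 1) * (n * Real.exp (-c * n)) +
          M * B⁻¹ * (n * Real.exp (-c * n)) +
          Real.exp 2 * D.factorial * (n * Real.exp (-c * n)) := by
          refine h.trans (add_le_add (add_le_add ?_ ?_) ?_)
          · gcongr
          · gcongr
          · exact e2.trans (le_mul_of_one_le_left e4 e3)
      _ = C * n * Real.exp (-c * n) := by
          rw [hC]
          ring
  · intro u hu hnu hεu
    have hu0 : 0 < u := by linarith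
    -- the number of links that are needed to bridge the gap `δ` is at least `2 u`
    obtain ⟨m, hm2⟩ : ∃ m : ℕ, ⌈2 * u⌉₊ = m + 2 := by
      have : 2 ≤ ⌈2 * u⌉₊ := by
        have h := Nat.le_ceil (2 * u)
        have : (2 : ℝ) ≤ ⌈2 * u⌉₊ := by linarith
        exact_mod_cast this
      exact ⟨⌈2 * u⌉₊ - 2, by omega⟩
    have hm_le : 2 * u ≤ m + 2 := by
      have h := Nat.le_ceil (2 * u)
      rw [hm2] at h
      exact_mod_cast h
    have hm_lt : (m : ℝ) + 1 < 2 * u := by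
      have h := Nat.ceil_lt_add_one (by positivity : 0 ≤ 2 * u)
      rw [hm2] at h
      push_cast at h
      linarith
    have hmδ : (m + 1) * (τ / u) < δ := by
      have := mul_lt_mul_of_pos_right hm_lt (by positivity : 0 < τ / u)
      have e : 2 * u * (τ / u) = 2 * τ := by field_simp
      linarith
    have h := hterms u m hu hmδ
    have hv1 : 1 ≤ u ^ maxDim P := Real.one_le_rpow hu hd
    have hnv : n / u ^ maxDim P ≤ u := by
      rw [div_le_iff₀ (by positivity)]
      rw [Real.rpow_add hu0, Real.rpow_one] at hnu
      linarith
    set v := u ^ maxDim P with hv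
    have hnv0 : 0 ≤ n / v := by positivity
    have hnε : 0 ≤ n * ε := by positivity
    have hbase : n * (K * ε * (τ / u) ^ D) ≤ Real.exp (-1) := by
      have hτD : τ ^ D ≤ τ := pow_le_of_le_one hτ0.le hτ1 hD.ne'
      calc n * (K * ε * (τ / u) ^ D) = K * τ ^ D * (n * ε / u ^ D) := by
            rw [div_pow]
            ring
        _ ≤ K * τ * 1 := by
            gcongr
            exact (div_le_one (by positivity)).2 hεu
        _ ≤ Real.exp (-1) := by rwa [mul_one]
    have hchain : n * ε * (n * (K * ε * (τ / u) ^ D)) ^ m ≤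
        Real.exp 2 * D.factorial * (v * Real.exp (-c * (n / v))) := by
      have e1 : u ^ D ≤ D.factorial * Real.exp u := by
        have := Real.pow_div_factorial_le_exp u hu0.le D
        rwa [div_le_iff₀ (by positivity), mul_comm] at this
      have e2 : Real.exp (-u) ≤ v * Real.exp (-c * (n / v)) := by
        refine le_trans ?_ (le_mul_of_one_le_left (Real.exp_nonneg _) hv1)
        rw [Real.exp_le_exp]
        linarith [mul_le_mul_of_nonneg_right hc1 hnv0]
      calc n * ε * (n * (K * ε * (τ / u) ^ D)) ^ m
          ≤ u ^ D * Real.exp (-1) ^ m := by gcongr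
        _ ≤ D.factorial * Real.exp u * Real.exp (2 - 2 * u) := by
            rw [← Real.exp_nat_mul]
            gcongr
            linarith
        _ = Real.exp 2 * D.factorial * Real.exp (-u) := by
            rw [show 2 - 2 * u = 2 + -u + -u by ring, Real.exp_add, Real.exp_add]
            have : Real.exp u * Real.exp (-u) = 1 := by rw [← Real.exp_add]; simp
            linear_combination (D.factorial * Real.exp 2 * Real.exp (-u)) * this
        _ ≤ _ := by gcongr
    calc risk μ P X ≤ _ := h
      _ ≤ 2 * (M + 1) * (v * Real.exp (-c * (n / v))) +
          M * B⁻¹ * (v * Real.exp (-c * (n / v))) +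
          Real.exp 2 * D.factorial * (v * Real.exp (-c * (n / v))) := by gcongr
      _ = C * v * Real.exp (-c * (n / v)) := by
          rw [hC]
          ring

end OSL

theorem mainTheorem5 (D M : ℕ) (d δ κ₀ κc : ℝ) (γ κ : Fin M → ℝ) :
    ∃ C₁ > 0, ∃ C₂ > 0,
      ∀ (P₀ : Measure (OSL.Space D)) (P : Fin M → Measure (OSL.Space D)),
        OSL.IsModel P₀ P γ → OSL.maxDim P = d →
        OSL.A1 P δ → OSL.A2 P₀ P κ₀ → OSL.A3 P κ → OSL.A4 P κc → OSL.A5 P →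
      ∀ (n : ℕ) (ε : ℝ), M ≤ n → OSL.A6 γ ε →
      ∀ (Ω : Type*) [MeasurableSpace Ω] (μ : Measure Ω) [IsProbabilityMeasure μ]
        (X : Fin n → Ω → OSL.Space D), OSL.IsSample μ X (OSL.mixture P₀ P γ ε) →
        -- few outliers
        (ε = Real.exp (-n) →
          OSL.risk μ P X ≤ C₁ * n * Real.exp (-C₂ * n)) ∧
        -- small dimensions of the supports
        (d + 1 < D →
          OSL.risk μ P X ≤ C₁ * n * Real.exp (-C₂ * (n : ℝ) ^ (1 / (d + 1)))) ∧
        -- large dimensions of the supports with few outliers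
        (∀ β : ℝ, d ≤ D → D ≤ d + 1 → ε = (n : ℝ) ^ (-β) → 1 - D / (d + 1) ≤ β →
          OSL.risk μ P X ≤
            C₁ * (n : ℝ) ^ (d / (d + 1)) * Real.exp (-C₂ * (n : ℝ) ^ (1 / (d + 1)))) ∧
        -- large dimensions of the supports with many outliers
        (∀ β : ℝ, d ≤ D → D ≤ d + 1 → ε = (n : ℝ) ^ (-β) → 0 < β → β < 1 - D / (d + 1) →
          OSL.risk μ P X ≤
            C₁ * (n : ℝ) ^ ((1 - β) * d / D) *
              Real.exp (-C₂ * (n : ℝ) ^ (1 + (β - 1) * d / D))) := by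
  -- without a model there is nothing to show; a model imposes the signs of the parameters
  by_cases hex : ∃ (P₀ : Measure (OSL.Space D)) (P : Fin M → Measure (OSL.Space D)) (ε : ℝ),
      OSL.IsModel P₀ P γ ∧ OSL.maxDim P = d ∧ OSL.A1 P δ ∧ OSL.A2 P₀ P κ₀ ∧ OSL.A3 P κ ∧
        OSL.A4 P κc ∧ OSL.A6 γ ε
  swap
  · refine ⟨1, one_pos, 1, one_pos, ?_⟩
    intro P₀ P hm hd hA1 hA2 hA3 hA4 _ n ε _ hA6
    exact absurd ⟨P₀, P, ε, hm, hd, hA1, hA2, hA3, hA4, hA6⟩ hex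
  have hpar : 0 < D ∧ 0 < M ∧ 0 < δ ∧ 0 < κ₀ ∧ 1 ≤ κc ∧ (∀ i, 0 < κ i) ∧ 0 ≤ d ∧
      0 < OSL.gammaBar γ ∧ 0 < ⨅ i, γ i := by
    obtain ⟨P₀, P, ε, hm, hd, hA1, hA2, hA3, hA4, hA6⟩ := hex
    have hM : 0 < M := by
      rcases Nat.eq_zero_or_pos M with rfl | h
      · have := hm.weight_sum
        simp at this
      · exact h
    have hb := (hA6.slack hm.weight_nonneg hm.weight_sum).1
    have hsup : 0 ≤ ⨆ i, γ i := Real.iSup_nonneg hm.weight_nonneg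
    refine ⟨hm.dim_pos hM, hM, hA1.2.1, hA2.1, hA4.1, fun i => (hA3 i).1, ?_, hb, ?_⟩
    · exact hd ▸ (OSL.dim_nonneg _).trans (OSL.dim_le_maxDim P ⟨0, hM⟩)
    · have := hA6.1
      linarith
  obtain ⟨hD, hM, hδ, hκ₀, hκc, hκ, hd, hb, hγ⟩ := hpar
  obtain ⟨C, hC, c, hc, hmain⟩ := OSL.exists_risk_le_of_scale hD hM hδ hκ₀ hκc hκ hd hb hγ
  refine ⟨C, hC, c, hc, ?_⟩
  intro P₀ P hm hdim hA1 hA2 hA3 hA4 _ n ε hMn hA6 Ω _ μ _ X hX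
  obtain ⟨hexp, hscale⟩ := hmain P₀ P hm hdim hA1 hA2 hA3 hA4 n ε hMn hA6 Ω μ X hX
  have hn1 : (1 : ℝ) ≤ n := by exact_mod_cast (Nat.one_le_iff_ne_zero.2 hM.ne').trans hMn
  have hn0 : (0 : ℝ) < n := by linarith
  have hd1 : 0 < d + 1 := by linarith
  have hDpos : (0 : ℝ) < D := by exact_mod_cast hD
  obtain ⟨-, h0, h1, -⟩ := hA6.slack hm.weight_nonneg hm.weight_sum
  have hu1 : 1 ≤ (n : ℝ) ^ (1 / (d + 1)) := Real.one_le_rpow hn1 (by positivity)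
  have hun : (n : ℝ) ≤ ((n : ℝ) ^ (1 / (d + 1))) ^ (d + 1) := by
    rw [← Real.rpow_mul hn0.le, one_div_mul_cancel hd1.ne', Real.rpow_one]
  have hud : ((n : ℝ) ^ (1 / (d + 1))) ^ d = (n : ℝ) ^ (d / (d + 1)) := by
    rw [← Real.rpow_mul hn0.le]
    congr 1
    ring
  have hquot : (n : ℝ) / (n : ℝ) ^ (d / (d + 1)) = (n : ℝ) ^ (1 / (d + 1)) := by
    nth_rewrite 1 [← Real.rpow_one (n : ℝ)]
    rw [← Real.rpow_sub hn0]
    congr 1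
    field_simp
    ring
  have huD : ((n : ℝ) ^ (1 / (d + 1))) ^ D = (n : ℝ) ^ ((D : ℝ) / (d + 1)) := by
    rw [← Real.rpow_natCast, ← Real.rpow_mul hn0.le]
    congr 1
    ring
  refine ⟨hexp, fun hdD => ?_, fun β _ _ hε hβ => ?_, fun β _ hDd hε hβ0 hβ => ?_⟩
  · have h := hscale _ hu1 hun (by
      rw [huD]
      calc (n : ℝ) * ε ≤ (n : ℝ) ^ (1 : ℝ) := by rw [Real.rpow_one]; nlinarith
        _ ≤ (n : ℝ) ^ ((D : ℝ) / (d + 1)) :=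
          Real.rpow_le_rpow_of_exponent_le hn1 ((one_le_div hd1).2 hdD.le))
    rw [hud, hquot] at h
    refine h.trans ?_
    gcongr
    calc (n : ℝ) ^ (d / (d + 1)) ≤ (n : ℝ) ^ (1 : ℝ) :=
          Real.rpow_le_rpow_of_exponent_le hn1 ((div_le_one hd1).2 (by linarith))
      _ = n := Real.rpow_one _
  · have h := hscale _ hu1 hun (by
      rw [huD, hε]
      nth_rewrite 1 [← Real.rpow_one (n : ℝ)]
      rw [← Real.rpow_add hn0]
      exact Real.rpow_le_rpow_of_exponent_le hn1 (by linarith))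
    rwa [hud, hquot] at h
  · -- here the scale is the one at which a ball is expected to contain about one outlier
    have hβ1 : 0 < 1 - β := by
      have : 0 < (D : ℝ) / (d + 1) := by positivity
      linarith
    have hβ2 : (D : ℝ) ≤ (1 - β) * (d + 1) := by
      have : (D : ℝ) / (d + 1) ≤ 1 - β := by linarith
      rwa [div_le_iff₀ hd1] at this
    have h := hscale ((n : ℝ) ^ ((1 - β) / D)) (Real.one_le_rpow hn1 (by positivity)) (by
      rw [← Real.rpow_mul hn0.le]
      nth_rewrite 1 [← Real.rpow_one (n : ℝ)]
      refine Real.rpow_le_rpow_of_exponent_le hn1 ?_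
      rw [div_mul_eq_mul_div, one_le_div hDpos]
      exact hβ2) (by
      rw [hε, ← Real.rpow_natCast, ← Real.rpow_mul hn0.le, div_mul_cancel₀ _ hDpos.ne']
      nth_rewrite 1 [← Real.rpow_one (n : ℝ)]
      rw [← Real.rpow_add hn0, sub_eq_add_neg])
    have e1 : ((n : ℝ) ^ ((1 - β) / D)) ^ d = (n : ℝ) ^ ((1 - β) * d / D) := by
      rw [← Real.rpow_mul hn0.le]
      congr 1
      ring
    have e2 : (n : ℝ) / (n : ℝ) ^ ((1 - β) * d / D) = (n : ℝ) ^ (1 + (β - 1) * d / D) := by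
      nth_rewrite 1 [← Real.rpow_one (n : ℝ)]
      rw [← Real.rpow_sub hn0]
      congr 1
      ring
    rwa [e1, e2] at h
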